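/- Let $F$ be a non-archimedean local field with ring of integers $O_F$, maximal ideal $\mathfrak p$, a prime element $\varpi$, and residue field of characteristic $p\neq 2$. Let $\tau:F\to\mathbb C^\times$ be a continuous unitary additive character with $\{x\in F\mid \tau(xO_F)=1\}=O_F$. Let $n$ be an integer with $p\nmid n$, let $K/F$ be a field extension of degree $n$ with ring of integers $O_K$, and let $e$ be its ramification index. Let $\beta\in O_K$ satisfy $O_K=O_F[\beta]$ and $\mathrm{Tr}_{K/F}(\beta)=0$. Fix an $O_F$-basis of $O_K$ and regard $\beta$ as an element of $\mathfrak{sl}_n(O_F)\subset M_n(O_F)$, namely as the matrix of multiplication by $\beta$ with respect to this basis. Let $r\ge 2$ be an integer, $l'=\lfloor r/2\rfloor$ and $l=r-l'$. Let $G(\mathfrak p^l/\mathfrak p^r)$ be the kernel of the reduction map $SL_n(O_F/\mathfrak p^r)\to SL_n(O_F/\mathfrak p^l)$, and let $\psi_\beta$ be the character of this group given by $$\psi_\beta\big(\overline{1_n+\varpi^l X}\big)=\tau\big(\varpi^{-l'}\,\mathrm{tr}(X\beta)\big).$$ Let $\delta$ be an irreducible complex representation of $SL_n(O_F/\mathfrak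 p^r)$ whose restriction to $G(\mathfrak p^l/\mathfrak p^r)$ contains $\psi_\beta$, and regard $\delta$ as a representation of $SL_n(O_F)$ via the reduction map $SL_n(O_F)\to SL_n(O_F/\mathfrak p^r)$. If $r\ge 2e$, then the compactly induced representation $\mathrm{ind}_{SL_n(O_F)}^{SL_n(F)}\delta$ is an irreducible supercuspidal representation of $SL_n(F)$. That is, it is irreducible and admissible, and all its matrix coefficients $g\mapsto\langle\pi(g)v,\xi\rangle$, with $\xi$ in the smooth dual, are compactly supported modulo the centre. -/

import Mathlib

open ValuativeRel Matrix

set_option linter.unusedSectionVars false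

noncomputable section

/-! ### Smooth representations of topological groups -/

section SmoothRepresentations

variable {G V : Type*} [Group G] [TopologicalSpace G] [AddCommGroup V] [Module ℂ V]

/-- A vector is smooth if it is fixed by an open subgroup. -/
def IsSmoothVector (π : Representation ℂ G V) (v : V) : Prop :=
  ∃ U : Subgroup G, IsOpen (U : Set G) ∧ ∀ u ∈ U, π u v = v

/-- A representation is smooth if all its vectors are smooth. -/
def IsSmoothRep (π : Representation ℂ G V) : Prop :=
  ∀ v, IsSmoothVector π v

/-- A representation is admissible if it is smooth and the space of vectors fixed by any
compact open subgroup is finite-dimensional. -/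
def IsAdmissibleRep (π : Representation ℂ G V) : Prop :=
  IsSmoothRep π ∧
    ∀ U : Subgroup G, IsOpen (U : Set G) → IsCompact (U : Set G) →
      FiniteDimensional ℂ (Representation.invariants (π.comp U.subtype))

/-- A representation is supercuspidal if it is admissible and every matrix coefficient
`g ↦ ⟨π(g) v, ξ⟩`, with `v` in the space of `π` and `ξ` in its smooth dual, is compactly
supported modulo the centre of the group. (Irreducibility is not part of this definition and is
stated separately.) -/
def IsSupercuspidalRep (π : Representation ℂ G V) : Prop :=
  IsAdmissibleRep π ∧
    ∀ (v : V) (ξ : Module.Dual ℂ V), IsSmoothVector π.dual ξ →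
      ∃ C : Set G, IsCompact C ∧
        ∀ g : G, ξ (π g v) ≠ 0 → ∃ c ∈ C, ∃ z ∈ Subgroup.center G, g = c * z

end SmoothRepresentations

/-! ### Compact induction -/

section CompactInduction

variable {H G V : Type*} [Group H] [Group G] [TopologicalSpace G] [IsTopologicalGroup G]
  [AddCommGroup V] [Module ℂ V]

/-- The space of the compactly induced representation: the functions `f : G → V` with
`f (φ h * g) = δ h (f g)` that are invariant under right translation by some open subgroup,
and whose support is compact modulo the image of `H`. -/
def compactIndV (φ : H →* G) (δ : Representation ℂ H V) : Submodule ℂ (G → V) where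
  carrier := {f |
    (∀ (h : H) (g : G), f (φ h * g) = δ h (f g)) ∧
    (∃ U : Subgroup G, IsOpen (U : Set G) ∧ ∀ g : G, ∀ u ∈ U, f (g * u) = f g) ∧
    ∃ C : Set G, IsCompact C ∧ ∀ g : G, f g ≠ 0 → ∃ h : H, ∃ c ∈ C, g = φ h * c}
  zero_mem' := ⟨fun _ _ => by simp, ⟨⊤, isOpen_univ, fun _ _ _ => rfl⟩, ∅, isCompact_empty,
    fun _ hg => absurd rfl hg⟩
  add_mem' := by
    rintro f₁ f₂ ⟨e₁, ⟨U₁, hU₁, h₁⟩, C₁, hC₁, k₁⟩ ⟨e₂, ⟨U₂, hU₂, h₂⟩, C₂, hC₂, k₂⟩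
    refine ⟨fun h g => ?_, ⟨U₁ ⊓ U₂, hU₁.inter hU₂, fun g u hu => ?_⟩, C₁ ∪ C₂, hC₁.union hC₂,
      fun g hg => ?_⟩
    · simp [e₁, e₂]
    · simp only [Pi.add_apply]
      rw [h₁ g u hu.1, h₂ g u hu.2]
    · by_cases h0 : f₁ g = 0
      · have h0' : f₂ g ≠ 0 := by
          intro h0'
          apply hg
          rw [Pi.add_apply, h0, h0', add_zero]
        obtain ⟨h, c, hc, e⟩ := k₂ g h0'
        exact ⟨h, c, Or.inr hc, e⟩
      · obtain ⟨h, c, hc, e⟩ := k₁ g h0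
        exact ⟨h, c, Or.inl hc, e⟩
  smul_mem' := by
    rintro a f ⟨e, ⟨U, hU, h₁⟩, C, hC, k₁⟩
    refine ⟨fun h g => ?_, ⟨U, hU, fun g u hu => ?_⟩, C, hC, fun g hg => ?_⟩
    · simp [e]
    · simp only [Pi.smul_apply]
      rw [h₁ g u hu]
    · refine k₁ g fun h0 => hg ?_
      rw [Pi.smul_apply, h0, smul_zero]

theorem compactIndV_translate (φ : H →* G) (δ : Representation ℂ H V) (x : G) (f : G → V)
    (hf : f ∈ compactIndV φ δ) : (fun g => f (g * x)) ∈ compactIndV φ δ := by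
  obtain ⟨e, ⟨U, hU, h₁⟩, C, hC, k₁⟩ := hf
  refine ⟨fun h g => ?_, ⟨U.comap (MulAut.conj x⁻¹).toMonoidHom, ?_, fun g u hu => ?_⟩,
    (fun c => c * x⁻¹) '' C, hC.image (by fun_prop), fun g hg => ?_⟩
  · simp only [mul_assoc, e]
  · have hc : Continuous fun y : G => x⁻¹ * y * x := by fun_prop
    have : ((U.comap (MulAut.conj x⁻¹).toMonoidHom : Subgroup G) : Set G)
        = (fun y : G => x⁻¹ * y * x) ⁻¹' (U : Set G) := by
      ext y
      simp
    rw [this]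
    exact hU.preimage hc
  · have hu' : x⁻¹ * u * x ∈ U := by simpa using hu
    change f (g * u * x) = f (g * x)
    rw [← h₁ (g * x) _ hu', show g * x * (x⁻¹ * u * x) = g * u * x by group]
  · obtain ⟨h, c, hc, e'⟩ := k₁ (g * x) hg
    refine ⟨h, c * x⁻¹, ⟨c, hc, rfl⟩, ?_⟩
    rw [← mul_assoc, ← e', mul_inv_cancel_right]

/-- The compactly induced representation `ind_H^G δ` of `G`, for a homomorphism `φ : H → G`
(usually the inclusion of an open subgroup). The group `G` acts by right translation,
`(x • f)(g) = f (g * x)`. -/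
def compactInd (φ : H →* G) (δ : Representation ℂ H V) :
    Representation ℂ G (compactIndV φ δ) where
  toFun x := (LinearMap.funLeft ℂ V (· * x)).restrict (compactIndV_translate φ δ x)
  map_one' := by
    ext f g
    simp [LinearMap.funLeft]
  map_mul' x y := by
    ext f g
    simp [LinearMap.funLeft, mul_assoc]

theorem compactInd_apply (φ : H →* G) (δ : Representation ℂ H V) (x : G)
    (f : compactIndV φ δ) (g : G) :
    (compactInd φ δ x f : G → V) g = (f : G → V) (g * x) := rfl

end CompactInduction

/-! ### Congruence kernels and the character attached to a matrix -/

/-- The kernel of the reduction map `SL_n(R/J) → SL_n(R/I)`, for ideals `J ⊆ I` of `R`. -/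
def congruenceKernel (n : ℕ) {R : Type*} [CommRing R] {I J : Ideal R} (h : J ≤ I) :
    Subgroup (SpecialLinearGroup (Fin n) (R ⧸ J)) :=
  (SpecialLinearGroup.map (n := Fin n) (Ideal.Quotient.factor h)).ker

section Psi

variable {F : Type*} [Field F] [ValuativeRel F] [TopologicalSpace F]
  [IsNonarchimedeanLocalField F]

/-- The group `G(𝔭^l/𝔭^r)` with `G = SL_n` and `l = ⌈r/2⌉`, that is, the kernel of
`SL_n(O_F/𝔭^r) → SL_n(O_F/𝔭^l)`. -/
def halfKernel (F : Type*) [Field F] [ValuativeRel F] [TopologicalSpace F]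
    [IsNonarchimedeanLocalField F] (n r : ℕ) :
    Subgroup (SpecialLinearGroup (Fin n) (𝒪[F] ⧸ 𝓂[F] ^ r)) :=
  congruenceKernel n (Ideal.pow_le_pow_right (I := 𝓂[F]) (show (r + 1) / 2 ≤ r by omega))

/-- Every element of `G(𝔭^l/𝔭^r)` is the class modulo `𝔭^r` of a matrix `1 + ϖ^l X`. -/
theorem halfKernel_exists_lift {n r : ℕ} {ϖ : 𝒪[F]} (hϖ : Irreducible ϖ)
    (h : halfKernel F n r) :
    ∃ X : Matrix (Fin n) (Fin n) 𝒪[F],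
      (1 + ϖ ^ ((r + 1) / 2) • X).map (Ideal.Quotient.mk (𝓂[F] ^ r)) =
        (h : SpecialLinearGroup (Fin n) (𝒪[F] ⧸ 𝓂[F] ^ r)) := by
  obtain ⟨g, hg⟩ := h
  have key : ∀ i j, ∃ x : 𝒪[F],
      Ideal.Quotient.mk (𝓂[F] ^ r) ((1 : Matrix (Fin n) (Fin n) 𝒪[F]) i j
        + ϖ ^ ((r + 1) / 2) * x) = g i j := by
    intro i j
    obtain ⟨y, hy⟩ := Ideal.Quotient.mk_surjective (g i j)
    have h1 : Ideal.Quotient.mk (𝓂[F] ^ ((r + 1) / 2)) y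
        = (1 : Matrix (Fin n) (Fin n) (𝒪[F] ⧸ 𝓂[F] ^ ((r + 1) / 2))) i j := by
      have := congrArg (fun A : SpecialLinearGroup (Fin n) _ => A i j)
        (MonoidHom.mem_ker.1 hg)
      simpa [← hy] using this
    have h2 : y - (1 : Matrix (Fin n) (Fin n) 𝒪[F]) i j ∈ 𝓂[F] ^ ((r + 1) / 2) := by
      rw [← Ideal.Quotient.eq, h1]
      by_cases hij : i = j
      · subst hij; simp
      · simp [Matrix.one_apply_ne hij]
    rw [hϖ.maximalIdeal_eq, Ideal.span_singleton_pow, Ideal.mem_span_singleton] at h2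
    obtain ⟨x, hx⟩ := h2
    refine ⟨x, ?_⟩
    rw [← hx, ← hy]
    congr 1
    ring
  choose X hX using key
  refine ⟨Matrix.of X, ?_⟩
  ext i j
  simpa using hX i j

/-- The value `τ(ϖ^{-l'} tr(Xβ))`, where `l' = ⌊r/2⌋`. -/
def psiValue {n : ℕ} (τ : AddChar F Circle) (ϖ : 𝒪[F]) (r : ℕ)
    (β X : Matrix (Fin n) (Fin n) 𝒪[F]) : Circle :=
  τ (((ϖ : F) ^ (r / 2))⁻¹ * ((X * β).trace : 𝒪[F]))

theorem psiValue_add {n : ℕ} (τ : AddChar F Circle) (ϖ : 𝒪[F]) (r : ℕ)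
    (β X Y : Matrix (Fin n) (Fin n) 𝒪[F]) :
    psiValue τ ϖ r β (X + Y) = psiValue τ ϖ r β X * psiValue τ ϖ r β Y := by
  simp only [psiValue]
  rw [← AddChar.map_add_eq_mul, Matrix.add_mul, Matrix.trace_add]
  push_cast
  rw [mul_add]

theorem psiValue_smul {n : ℕ} {τ : AddChar F Circle} (hτ : ∀ x : 𝒪[F], τ (x : F) = 1)
    {ϖ : 𝒪[F]} (hϖ : Irreducible ϖ) {r : ℕ} (β X : Matrix (Fin n) (Fin n) 𝒪[F]) :
    psiValue τ ϖ r β (ϖ ^ (r / 2) • X) = 1 := by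
  have h0 : (ϖ : F) ≠ 0 := by
    simpa using hϖ.ne_zero
  simp only [psiValue]
  rw [Matrix.smul_mul, Matrix.trace_smul, smul_eq_mul]
  push_cast
  rw [inv_mul_cancel_left₀ (pow_ne_zero _ h0)]
  exact hτ _

/-- `τ(ϖ^{-l'} tr(Xβ))` depends only on the class of `1 + ϖ^l X` modulo `𝔭^r`. -/
theorem psiValue_congr {n : ℕ} {τ : AddChar F Circle} (hτ : ∀ x : 𝒪[F], τ (x : F) = 1)
    {ϖ : 𝒪[F]} (hϖ : Irreducible ϖ) {r : ℕ} (β : Matrix (Fin n) (Fin n) 𝒪[F])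
    {X Y : Matrix (Fin n) (Fin n) 𝒪[F]}
    (h : (1 + ϖ ^ ((r + 1) / 2) • X).map (Ideal.Quotient.mk (𝓂[F] ^ r)) =
      (1 + ϖ ^ ((r + 1) / 2) • Y).map (Ideal.Quotient.mk (𝓂[F] ^ r))) :
    psiValue τ ϖ r β X = psiValue τ ϖ r β Y := by
  have key : ∀ i j, ∃ z : 𝒪[F], X i j = Y i j + ϖ ^ (r / 2) * z := by
    intro i j
    have h1 := congrFun (congrFun h i) j
    simp only [Matrix.map_apply, Matrix.add_apply, Matrix.smul_apply, smul_eq_mul] at h1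
    rw [Ideal.Quotient.eq, hϖ.maximalIdeal_eq, Ideal.span_singleton_pow,
      Ideal.mem_span_singleton] at h1
    obtain ⟨z, hz⟩ := h1
    refine ⟨z, mul_left_cancel₀ (pow_ne_zero ((r + 1) / 2) hϖ.ne_zero) ?_⟩
    have hr : ϖ ^ r = ϖ ^ ((r + 1) / 2) * ϖ ^ (r / 2) := by
      rw [← pow_add]; congr 1; omega
    rw [hr] at hz
    linear_combination hz
  choose Z hZ using key
  have hX : X = Y + ϖ ^ (r / 2) • Matrix.of Z := by
    ext i j
    simp [hZ i j]
  rw [hX, psiValue_add, psiValue_smul hτ hϖ, mul_one]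

/-- The character `ψ_β` of `G(𝔭^l/𝔭^r)`, given by `ψ_β(1 + ϖ^l X) = τ(ϖ^{-l'} tr(Xβ))`
(see `psi_apply`), where `l = ⌈r/2⌉` and `l' = ⌊r/2⌋`. -/
def psi {n : ℕ} (τ : AddChar F Circle) (hτ : ∀ x : 𝒪[F], τ (x : F) = 1)
    (ϖ : 𝒪[F]) (hϖ : Irreducible ϖ) (r : ℕ) (β : Matrix (Fin n) (Fin n) 𝒪[F]) :
    halfKernel F n r →* Circle :=
  MonoidHom.mk' (fun h => psiValue τ ϖ r β (halfKernel_exists_lift hϖ h).choose) <| by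
    intro a b
    have ha := (halfKernel_exists_lift hϖ a).choose_spec
    have hb := (halfKernel_exists_lift hϖ b).choose_spec
    have hab := (halfKernel_exists_lift hϖ (a * b)).choose_spec
    set A := (halfKernel_exists_lift hϖ a).choose
    set B := (halfKernel_exists_lift hϖ b).choose
    have e : ϖ ^ ((r + 1) / 2) = ϖ ^ (r / 2) * ϖ ^ ((r + 1) / 2 - r / 2) := by
      rw [← pow_add]; congr 1; omega
    have hmul : (1 + ϖ ^ ((r + 1) / 2) • A) * (1 + ϖ ^ ((r + 1) / 2) • B) =
        1 + ϖ ^ ((r + 1) / 2) • (A + B +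
          ϖ ^ (r / 2) • (ϖ ^ ((r + 1) / 2 - r / 2) • (A * B))) := by
      rw [smul_smul (ϖ ^ (r / 2)), ← e, add_mul, mul_add, mul_add, one_mul, mul_one, one_mul,
        Matrix.smul_mul, Matrix.mul_smul, smul_add, smul_add]
      abel
    rw [← psiValue_add, ← mul_one (psiValue τ ϖ r β (A + B)),
      ← psiValue_smul hτ hϖ β (ϖ ^ ((r + 1) / 2 - r / 2) • (A * B)), ← psiValue_add]
    refine psiValue_congr hτ hϖ β ?_
    rw [hab, ← hmul, Matrix.map_mul, ha, hb]
    rfl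

theorem psi_apply {n : ℕ} (τ : AddChar F Circle) (hτ : ∀ x : 𝒪[F], τ (x : F) = 1)
    (ϖ : 𝒪[F]) (hϖ : Irreducible ϖ) (r : ℕ) (β : Matrix (Fin n) (Fin n) 𝒪[F])
    (h : halfKernel F n r) (X : Matrix (Fin n) (Fin n) 𝒪[F])
    (hX : (1 + ϖ ^ ((r + 1) / 2) • X).map (Ideal.Quotient.mk (𝓂[F] ^ r)) =
      (h : SpecialLinearGroup (Fin n) (𝒪[F] ⧸ 𝓂[F] ^ r))) :
    psi τ hτ ϖ hϖ r β h = psiValue τ ϖ r β X :=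
  psiValue_congr hτ hϖ β ((halfKernel_exists_lift hϖ h).choose_spec.trans hX.symm)

/-- The condition `{x ∈ F | τ(x O_F) = 1} = O_F` on an additive character `τ` of `F`. -/
def HasConductorO (τ : AddChar F Circle) : Prop :=
  {x : F | ∀ y : 𝒪[F], τ (x * y) = 1} = (𝒪[F] : Set F)

theorem HasConductorO.apply_eq_one {τ : AddChar F Circle} (hτ : HasConductorO τ) (x : 𝒪[F]) :
    τ (x : F) = 1 := by
  have hx : (x : F) ∈ {x : F | ∀ y : 𝒪[F], τ (x * y) = 1} := by
    rw [hτ]; exact x.2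
  simpa using hx 1

end Psi

/-- The restriction of a representation of `G` to a subgroup `H` contains the
character `χ` of `H`: some nonzero vector transforms under `H` by `χ`. -/
def ContainsCharacter {G V : Type*} [Group G] [AddCommGroup V] [Module ℂ V]
    (δ : Representation ℂ G V) (H : Subgroup G) (χ : H →* Circle) : Prop :=
  ∃ v : V, v ≠ 0 ∧ ∀ h : H, δ (h : G) v = (χ h : ℂ) • v

section SpecialLinear

variable (F : Type*) [Field F] [ValuativeRel F] [TopologicalSpace F]
  [IsNonarchimedeanLocalField F]

/-- The inclusion `SL_n(O_F) → SL_n(F)`. -/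
def slInclusion (n : ℕ) :
    SpecialLinearGroup (Fin n) 𝒪[F] →* SpecialLinearGroup (Fin n) F :=
  SpecialLinearGroup.map (algebraMap 𝒪[F] F)

/-- The reduction map `SL_n(O_F) → SL_n(O_F/𝔭^r)`. -/
def slReduction (n r : ℕ) :
    SpecialLinearGroup (Fin n) 𝒪[F] →* SpecialLinearGroup (Fin n) (𝒪[F] ⧸ 𝓂[F] ^ r) :=
  SpecialLinearGroup.map (Ideal.Quotient.mk (𝓂[F] ^ r))

end SpecialLinear

end

/-! ### Finite extensions of complete local rings are local -/

/-! Write H = SL_n(O_F), K_m for its congruence subgroup of level m, and ρ for the inflation of δ to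
H. A function in the induced space that is invariant under an open subgroup U takes at g a value
fixed by H ∩ gUg⁻¹. Everything therefore reduces to asking for which g such a nonzero vector can
exist. If this holds with U = K_r only for g in H, averaging over K_r turns any nonzero vector into
one supported on H, and the induced representation is irreducible (`compactInd_isIrreducible`). If
for each U such g stay in a compact set, admissibility and compactness of matrix coefficients follow
(`compactInd_isSupercuspidalRep`).

Let g = k₁ diag(ϖ^v) k₂ be a Cartan decomposition, with U containing K_m. Conjugates by k₁ of
elementary transvections of sufficiently high level lie in H ∩ gK_mg⁻¹, so some H-conjugate of ψ_β
is trivial on them. Since τ has conductor O_F, this says that off-diagonal entries (j, i) of a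
conjugate B = κβκ⁻¹ are divisible by powers of ϖ governed by v_j - v_i (`exists_conj_forall_dvd`).

The arithmetic input concerns a matrix Z close to multiplication by β. If a lattice cO_F^n inside
O_F^n is stable under Z, then its reduction modulo ϖ is stable under β, hence comes from an ideal of
O_K = O_F[β]. If that ideal is proper, it lies in (π), and c is divisible on the left by a matrix Q
that lifts π and commutes with Z. By descent on the determinant, c = Q^j u with u invertible
(`exists_eq_pow_mul_of_intertwines`). In the ramified case Q is a polynomial in Z and must divide ϖ;
this needs Z ≡ β modulo ϖ², which is what r ≥ 2e supplies.

For m = r, B can be changed modulo ϖ^{l'} so that it stabilizes the lattice of diag(ϖ^v), up to a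
scalar. As ∑ v_i = 0, comparison of determinants forces v = 0, so g is in H
(`eq_zero_of_forall_dvd_conj`). For general m, a large spread of v would have a gap, making B block
triangular modulo ϖ^{l'}; the resulting stable lattice contradicts the description by powers of Q
(`sub_le_of_forall_dvd_conj`). -/

theorem exists_isIdempotentElem_pow {M : Type*} [Monoid M] [Finite M] (x : M) :
    ∃ k : ℕ, k ≠ 0 ∧ IsIdempotentElem (x ^ k) := by
  obtain ⟨a, b, hab, h⟩ := Finite.exists_ne_map_eq_of_infinite (fun k : ℕ => x ^ k)
  wlog hlt : a < b generalizing a b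
  · exact this b a hab.symm h.symm (by omega)
  obtain ⟨d, rfl⟩ := Nat.exists_eq_add_of_lt hlt
  have step : ∀ k, a ≤ k → ∀ j, x ^ (k + j * (d + 1)) = x ^ k := by
    intro k hk j
    induction j with
    | zero => simp
    | succ j ih =>
      obtain ⟨c, rfl⟩ := Nat.exists_eq_add_of_le hk
      rw [← ih, show a + c + (j + 1) * (d + 1) = (a + d + 1) + (c + j * (d + 1)) by ring,
        show a + c + j * (d + 1) = a + (c + j * (d + 1)) by ring, pow_add, pow_add x a]
      exact congrArg (· * _) h.symm
  -- Powers of `x` have period `d + 1` from exponent `a` on. This exponent is a multiple of the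
  -- period and at least `a`, so doubling it changes nothing.
  refine ⟨(a + 1) * (d + 1), by positivity, ?_⟩
  rw [IsIdempotentElem, ← pow_add]
  exact step _ (by nlinarith) (a + 1)

theorem isPrecomplete_of_basis {R M ι : Type*} [CommRing R] [AddCommGroup M] [Module R M]
    [Fintype ι] (b : Module.Basis ι R M) (I : Ideal R) [IsPrecomplete I R] :
    IsPrecomplete I M := by
  have key : ∀ (n : ℕ) (x y : M), x ≡ y [SMOD (I ^ n • ⊤ : Submodule R M)] ↔
      ∀ i, b.repr x i ≡ b.repr y i [SMOD (I ^ n • ⊤ : Submodule R R)] := by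
    intro n x y
    simp only [SModEq.sub_mem, ← Finsupp.sub_apply, ← map_sub]
    generalize x - y = z
    constructor
    · intro hz i
      have := Submodule.mem_map_of_mem (f := (Finsupp.lapply i).comp b.repr.toLinearMap) hz
      rw [Submodule.map_smul''] at this
      exact Submodule.smul_mono le_rfl le_top this
    · intro hz
      rw [← b.sum_repr z]
      refine Submodule.sum_mem _ fun i _ => Submodule.smul_mem_smul ?_ trivial
      simpa using hz i
  refine ⟨fun f hf => ?_⟩
  have h : ∀ i, ∃ L : R, ∀ n, b.repr (f n) i ≡ L [SMOD (I ^ n • ⊤ : Submodule R R)] :=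
    fun i => IsPrecomplete.prec' (fun n => b.repr (f n) i) fun hmn => (key _ _ _).1 (hf hmn) i
  choose L hL using h
  refine ⟨b.equivFun.symm L, fun n => (key _ _ _).2 fun i => ?_⟩
  have hr : b.repr (b.equivFun.symm L) i = L i := by
    rw [← b.equivFun_apply, LinearEquiv.apply_symm_apply]
  rw [hr]
  exact hL i n

/-- Some power of any `x` is idempotent in the finite quotient. Hensel's lemma for X² - X lifts it
to an idempotent of the domain `S`, which is 0 or 1. Since `J` lies in the Jacobson radical, `1 - x`
or `x` is accordingly a unit. -/
theorem isLocalRing_of_henselianRing {S : Type*} [CommRing S] [IsDomain S] (J : Ideal S)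
    [HenselianRing S J] [Finite (S ⧸ J)] : IsLocalRing S := by
  have hJ : J ≤ Ideal.jacobson ⊥ := HenselianRing.jac
  refine IsLocalRing.of_isUnit_or_isUnit_one_sub_self fun x => ?_
  obtain ⟨k, hk, he⟩ := exists_isIdempotentElem_pow (Ideal.Quotient.mk J x)
  obtain ⟨a, ha, hax⟩ := HenselianRing.is_henselian (I := J)
    (Polynomial.X ^ 2 - Polynomial.X : Polynomial S)
    ((Polynomial.monic_X_pow 2).sub_of_left (by simp)) (x ^ k)
    (by
      rw [← Ideal.Quotient.eq_zero_iff_mem]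
      simp only [Polynomial.eval_sub, Polynomial.eval_pow, Polynomial.eval_X, map_sub, map_pow]
      rw [sq, he.eq, sub_self])
    (by
      -- For an idempotent e, the derivative value 2e - 1 is its own inverse.
      refine IsUnit.of_mul_eq_one (Ideal.Quotient.mk J (2 * x ^ k - 1)) ?_
      simp only [Polynomial.derivative_X_pow, Polynomial.derivative_X,
        Polynomial.eval_sub, Polynomial.eval_mul, Polynomial.eval_C, Polynomial.eval_pow,
        Polynomial.eval_X, Polynomial.eval_one, map_sub, map_mul, map_pow, map_one]
      have := he.eq
      push_cast
      simp only [map_ofNat, pow_one]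
      linear_combination 4 * this)
  have ha' : a = 0 ∨ a = 1 := by
    have : a * (a - 1) = 0 := by
      have := ha
      simp only [Polynomial.IsRoot, Polynomial.eval_sub, Polynomial.eval_pow,
        Polynomial.eval_X] at this
      linear_combination this
    rcases mul_eq_zero.1 this with h | h
    · exact Or.inl h
    · exact Or.inr (sub_eq_zero.1 h)
  have hunit : ∀ y ∈ J, IsUnit (1 - y) := by
    intro y hy
    have := Ideal.mem_jacobson_bot.1 (hJ hy) (-1)
    simpa [sub_eq_neg_add] using this
  rcases ha' with rfl | rfl
  · right
    have h1 : IsUnit (1 - x ^ k) := hunit _ (by simpa using J.neg_mem hax)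
    have h2 : (1 - x) ∣ 1 - x ^ k := by simpa using sub_dvd_pow_sub_pow 1 x k
    exact isUnit_of_dvd_unit h2 h1
  · left
    have h1 := hunit _ hax
    rw [sub_sub_cancel] at h1
    exact (isUnit_pow_iff hk).1 h1

theorem isLocalRing_of_basis {R S ι : Type*} [CommRing R] [IsLocalRing R] [IsNoetherianRing R]
    [IsAdicComplete (IsLocalRing.maximalIdeal R) R] [Finite (IsLocalRing.ResidueField R)]
    [CommRing S] [IsDomain S] [Algebra R S] [Fintype ι] (b : Module.Basis ι R S) :
    IsLocalRing S := by
  have : Module.Finite R S := .of_basis b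
  have := isPrecomplete_of_basis b (IsLocalRing.maximalIdeal R)
  have : IsAdicComplete (IsLocalRing.maximalIdeal R) S := {}
  have : IsAdicComplete ((IsLocalRing.maximalIdeal R).map (algebraMap R S)) S :=
    (IsAdicComplete.map_algebraMap_iff _ _).2 this
  have : Finite (S ⧸ (IsLocalRing.maximalIdeal R).map (algebraMap R S)) := by
    have : Finite (R ⧸ IsLocalRing.maximalIdeal R) :=
      inferInstanceAs (Finite (IsLocalRing.ResidueField R))
    exact Module.finite_of_finite (R ⧸ IsLocalRing.maximalIdeal R)
  exact isLocalRing_of_henselianRing ((IsLocalRing.maximalIdeal R).map (algebraMap R S))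

theorem isLocalRing_integralClosure {F : Type*} [Field F] [ValuativeRel F] [TopologicalSpace F]
    [IsNonarchimedeanLocalField F] {K : Type*} [Field K] [Algebra F K] {n : ℕ}
    (b : Module.Basis (Fin n) 𝒪[F] (integralClosure 𝒪[F] K)) :
    IsLocalRing (integralClosure 𝒪[F] K) := by
  let := IsTopologicalAddGroup.rightUniformSpace F
  have := isUniformAddGroup_of_addCommGroup (G := F)
  exact isLocalRing_of_basis b

/-! ### Lattices stable under a perturbation of a generator -/

section Lattice

variable {R S : Type*} [CommRing R] [IsDomain R] [IsDiscreteValuationRing R] [CommRing S]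
  [IsDomain S] [IsLocalRing S] [Algebra R S] {n : ℕ}

theorem isUnit_det_of_residue_eq {A B : Matrix (Fin n) (Fin n) R} {ϖ : R} (hϖ : Irreducible ϖ)
    {Y : Matrix (Fin n) (Fin n) R} (h : A = B + ϖ • Y) (hA : IsUnit A.det) : IsUnit B.det := by
  have h0 : IsLocalRing.residue R ϖ = 0 := by
    rw [IsLocalRing.residue_eq_zero_iff]
    exact hϖ.not_isUnit
  have hAB : (IsLocalRing.residue R).mapMatrix A = (IsLocalRing.residue R).mapMatrix B := by
    ext i j
    simp [h, h0]
  have hdet : IsLocalRing.residue R A.det = IsLocalRing.residue R B.det := by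
    rw [RingHom.map_det, RingHom.map_det, hAB]
  refine isUnit_of_map_unit (IsLocalRing.residue R) _ ?_
  rw [← hdet]
  exact hA.map _

theorem isUnit_of_isUnit_leftMulMatrix (b : Module.Basis (Fin n) R S) {x : S}
    (hx : IsUnit (Algebra.leftMulMatrix b x).det) : IsUnit x := by
  have h := (Matrix.isUnit_iff_isUnit_det _).2 hx
  obtain ⟨A, hA⟩ := h.exists_right_inv
  refine IsUnit.of_mul_eq_one (b.equivFun.symm (A *ᵥ b.equivFun 1)) (b.equivFun.injective ?_)
  have key := Algebra.leftMulMatrix_mulVec_repr b x (b.equivFun.symm (A *ᵥ b.equivFun 1))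
  rw [← b.equivFun_apply, ← b.equivFun_apply, LinearEquiv.apply_symm_apply, mulVec_mulVec, hA,
    one_mulVec] at key
  exact key.symm

theorem equivFun_mul (b : Module.Basis (Fin n) R S) (x y : S) :
    b.equivFun (x * y) = Algebra.leftMulMatrix b x *ᵥ b.equivFun y := by
  rw [b.equivFun_apply, b.equivFun_apply, Algebra.leftMulMatrix_mulVec_repr]

/-- A singular matrix whose column lattice is stable under a perturbation `Z` of the
multiplication by `β` is divisible on the left by `Q`, a perturbation of the multiplication by a
uniformizer. -/
theorem exists_eq_mul_of_intertwines (b : Module.Basis (Fin n) R S) {ϖ : R} (hϖ : Irreducible ϖ)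
    {β : S} (hβ : Algebra.adjoin R {β} = ⊤) {π : S}
    (hπ : IsLocalRing.maximalIdeal S = Ideal.span {π})
    {Z Y Q Q' X : Matrix (Fin n) (Fin n) R} (hZ : Z = Algebra.leftMulMatrix b β + ϖ • Y)
    (hQ : Q = Algebra.leftMulMatrix b π + ϖ • X) (hQQ : Q * Q' = ϖ • 1)
    {c W : Matrix (Fin n) (Fin n) R} (hc : Z * c = c * W) (hdet : ¬ IsUnit c.det) :
    ∃ d, c = Q * d := by
  -- The lattice generated by the columns of `c` and by `ϖ`, transported to `S`. Adding the
  -- multiples of `ϖ` makes it stable under `β` itself, not only under the perturbation `Z`.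
  let N : Submodule R S :=
    (LinearMap.range c.mulVecLin ⊔ LinearMap.range (ϖ • LinearMap.id)).comap
      b.equivFun.toLinearMap
  have hN : ∀ x, x ∈ N ↔ ∃ y z, c *ᵥ y + ϖ • z = b.equivFun x := by
    intro x
    simp [N, Submodule.mem_sup]
  have hβN : ∀ x ∈ N, β * x ∈ N := by
    intro x hx
    obtain ⟨y, z, h⟩ := (hN x).1 hx
    refine (hN _).2 ⟨W *ᵥ y, Z *ᵥ z - Y *ᵥ b.equivFun x, ?_⟩
    have hM : Algebra.leftMulMatrix b β = Z - ϖ • Y := by rw [hZ]; abel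
    rw [equivFun_mul, hM, sub_mulVec, mulVec_mulVec, ← hc, ← mulVec_mulVec, smul_sub,
      ← mulVec_smul Z, smul_mulVec]
    have hZx : Z *ᵥ b.equivFun x = Z *ᵥ c *ᵥ y + Z *ᵥ (ϖ • z) := by rw [← h, mulVec_add]
    rw [hZx]
    abel
  have hSN : ∀ s : S, ∀ x ∈ N, s * x ∈ N := by
    intro s
    have hs : s ∈ Algebra.adjoin R {β} := hβ ▸ trivial
    induction hs using Algebra.adjoin_induction with
    | mem s hs => rw [Set.mem_singleton_iff.1 hs]; exact hβN
    | algebraMap r => intro x hx; rw [← Algebra.smul_def]; exact N.smul_mem r hx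
    | add s t _ _ hs ht => intro x hx; rw [add_mul]; exact N.add_mem (hs x hx) (ht x hx)
    | mul s t _ _ hs ht => intro x hx; rw [mul_assoc]; exact hs _ (ht x hx)
  let I : Ideal S := { N with smul_mem' := fun s x hx => hSN s x hx }
  have hI : I ≤ IsLocalRing.maximalIdeal S := by
    refine IsLocalRing.le_maximalIdeal fun htop => hdet ?_
    have hall : ∀ v : Fin n → R, ∃ y z, c *ᵥ y + ϖ • z = v := by
      intro v
      have : b.equivFun.symm v ∈ I := htop ▸ trivial
      have h := (hN _).1 this
      rwa [LinearEquiv.apply_symm_apply] at h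
    choose y z hyz using fun j => hall (Pi.single j 1)
    have h1 : c * (Matrix.of y)ᵀ + ϖ • (Matrix.of z)ᵀ = 1 := by
      ext i j
      have := congrFun (hyz j) i
      simp only [Pi.add_apply, Pi.smul_apply] at this
      rw [Matrix.one_apply, ← Pi.single_apply, ← this]
      rfl
    have h2 : IsUnit (c * (Matrix.of y)ᵀ).det :=
      isUnit_det_of_residue_eq hϖ h1.symm (by simp)
    rw [det_mul] at h2
    exact isUnit_of_mul_isUnit_left h2
  have hcol : ∀ j, ∃ w, Algebra.leftMulMatrix b π *ᵥ w = c *ᵥ Pi.single j 1 := by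
    intro j
    have h1 : b.equivFun.symm (c *ᵥ Pi.single j 1) ∈ I :=
      (hN _).2 ⟨Pi.single j 1, 0, by rw [LinearEquiv.apply_symm_apply, smul_zero, add_zero]⟩
    have h2 := hI h1
    rw [hπ, Ideal.mem_span_singleton] at h2
    obtain ⟨t, ht⟩ := h2
    refine ⟨b.equivFun t, ?_⟩
    rw [← equivFun_mul, ← ht, LinearEquiv.apply_symm_apply]
  choose w hw using hcol
  have h1 : Algebra.leftMulMatrix b π * (Matrix.of w)ᵀ = c := by
    ext i j
    have := congrFun (hw j) i
    rw [mulVec_single_one] at this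
    exact this
  -- With `M` the matrix of `π` and `w` the matrix of coordinates, `c = M w = Q w - ϖ X w`; the
  -- error is absorbed by writing `ϖ = Q Q'`.
  refine ⟨(Matrix.of w)ᵀ - Q' * (X * (Matrix.of w)ᵀ), ?_⟩
  rw [mul_sub, ← mul_assoc, hQQ, Matrix.smul_mul, one_mul]
  nth_rewrite 1 [hQ]
  rw [add_mul, h1, Matrix.smul_mul]
  abel

theorem not_isUnit_det_of_uniformizer (b : Module.Basis (Fin n) R S) {ϖ : R}
    (hϖ : Irreducible ϖ) {π : S} (hπ : IsLocalRing.maximalIdeal S = Ideal.span {π})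
    {Q X : Matrix (Fin n) (Fin n) R} (hQ : Q = Algebra.leftMulMatrix b π + ϖ • X) :
    ¬ IsUnit Q.det := by
  intro h
  have h1 := isUnit_of_isUnit_leftMulMatrix b (isUnit_det_of_residue_eq hϖ hQ h)
  exact (IsLocalRing.maximalIdeal.isMaximal S).ne_top
    (hπ ▸ Ideal.span_singleton_eq_top.2 h1)

theorem det_ne_zero_of_mul_eq_smul {ϖ : R} (hϖ : Irreducible ϖ)
    {Q Q' : Matrix (Fin n) (Fin n) R} (hQQ : Q * Q' = ϖ • 1) : Q.det ≠ 0 := by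
  intro h
  have := congrArg Matrix.det hQQ
  rw [det_mul, h, zero_mul, det_smul, det_one, mul_one] at this
  exact pow_ne_zero _ hϖ.ne_zero this.symm

theorem matrix_mul_left_cancel {A B C : Matrix (Fin n) (Fin n) R} (hA : A.det ≠ 0)
    (h : A * B = A * C) : B = C := by
  have h1 := congrArg (A.adjugate * ·) h
  simp only [← mul_assoc, adjugate_mul, Matrix.smul_mul, one_mul] at h1
  exact smul_right_injective _ hA h1

/-- Factors `Q` can be split off as long as the determinant is not a unit. The quotient is again
stable because `Q` commutes with `Z`, and the valuation of its determinant is smaller because `det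
Q` is not a unit. -/
theorem exists_eq_pow_mul_of_intertwines (b : Module.Basis (Fin n) R S) {ϖ : R}
    (hϖ : Irreducible ϖ)
    {β : S} (hβ : Algebra.adjoin R {β} = ⊤) {π : S}
    (hπ : IsLocalRing.maximalIdeal S = Ideal.span {π})
    {Z Y Q Q' X : Matrix (Fin n) (Fin n) R} (hZ : Z = Algebra.leftMulMatrix b β + ϖ • Y)
    (hQ : Q = Algebra.leftMulMatrix b π + ϖ • X) (hQQ : Q * Q' = ϖ • 1) (hQZ : Q * Z = Z * Q)
    {c W : Matrix (Fin n) (Fin n) R} (hc : Z * c = c * W) (hdet : c.det ≠ 0) :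
    ∃ (j : ℕ) (u : Matrix (Fin n) (Fin n) R), IsUnit u.det ∧ c = Q ^ j * u := by
  have hQ0 := det_ne_zero_of_mul_eq_smul hϖ hQQ
  obtain ⟨k, hk⟩ := IsDiscreteValuationRing.associated_pow_irreducible hdet hϖ
  induction k using Nat.strong_induction_on generalizing c with
  | _ k ih =>
    by_cases hu : IsUnit c.det
    · exact ⟨0, c, hu, by simp⟩
    obtain ⟨d, rfl⟩ := exists_eq_mul_of_intertwines b hϖ hβ hπ hZ hQ hQQ hc hu
    have hd : Z * d = d * W := by
      apply matrix_mul_left_cancel hQ0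
      rw [← mul_assoc, hQZ, mul_assoc, hc, mul_assoc]
    rw [det_mul] at hdet hk
    have hd0 := right_ne_zero_of_mul hdet
    obtain ⟨k', hk'⟩ := IsDiscreteValuationRing.associated_pow_irreducible hd0 hϖ
    obtain ⟨a, ha⟩ := IsDiscreteValuationRing.associated_pow_irreducible hQ0 hϖ
    have ha0 : a ≠ 0 := by
      rintro rfl
      rw [pow_zero, associated_one_iff_isUnit] at ha
      exact not_isUnit_det_of_uniformizer b hϖ hπ hQ ha
    have hlt : k' < k := by
      have h1 : Associated (ϖ ^ k) (ϖ ^ (a + k')) := by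
        rw [pow_add]
        exact hk.symm.trans (ha.mul_mul hk')
      have h2 : a + k' ≤ k := (pow_dvd_pow_iff hϖ.ne_zero hϖ.not_isUnit).1 h1.symm.dvd
      omega
    obtain ⟨j, u, hu', rfl⟩ := ih k' hlt hd hd0 hk'
    exact ⟨j + 1, u, hu', by rw [pow_succ', mul_assoc]⟩

/-- The scalar matrix `ϖ` is itself stable under `Z`, so the classification by powers of `Q` applies
to it. The exponent `E` plays the role of the ramification index. -/
theorem exists_smul_eq_pow_mul (b : Module.Basis (Fin n) R S) {ϖ : R}
    (hϖ : Irreducible ϖ)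
    {β : S} (hβ : Algebra.adjoin R {β} = ⊤) {π : S}
    (hπ : IsLocalRing.maximalIdeal S = Ideal.span {π})
    {Z Y Q Q' X : Matrix (Fin n) (Fin n) R} (hZ : Z = Algebra.leftMulMatrix b β + ϖ • Y)
    (hQ : Q = Algebra.leftMulMatrix b π + ϖ • X) (hQQ : Q * Q' = ϖ • 1) (hQZ : Q * Z = Z * Q) :
    ∃ (E : ℕ) (u : Matrix (Fin n) (Fin n) R), IsUnit u.det ∧ Q ^ E = ϖ • u := by
  obtain ⟨E, u, hu, h⟩ := exists_eq_pow_mul_of_intertwines b hϖ hβ hπ hZ hQ hQQ hQZ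
    (c := ϖ • 1) (W := Z) (by simp) (by simp [hϖ.ne_zero])
  refine ⟨E, u⁻¹, by simpa using hu, ?_⟩
  have h1 := congrArg (· * u⁻¹) h
  simp only [mul_assoc, Matrix.mul_nonsing_inv _ hu, mul_one, Matrix.smul_mul, one_mul] at h1
  exact h1.symm

/-- If the column lattice of `c` is stable under `Z` and `c` has the determinant of `ϖ ^ N`, then
`c` is `ϖ ^ N` times a unit. -/
theorem exists_eq_smul_unit_of_intertwines (b : Module.Basis (Fin n) R S) {ϖ : R}
    (hϖ : Irreducible ϖ)
    {β : S} (hβ : Algebra.adjoin R {β} = ⊤) {π : S}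
    (hπ : IsLocalRing.maximalIdeal S = Ideal.span {π})
    {Z Y Q Q' X : Matrix (Fin n) (Fin n) R} (hZ : Z = Algebra.leftMulMatrix b β + ϖ • Y)
    (hQ : Q = Algebra.leftMulMatrix b π + ϖ • X) (hQQ : Q * Q' = ϖ • 1) (hQZ : Q * Z = Z * Q)
    {c W : Matrix (Fin n) (Fin n) R} (hc : Z * c = c * W) {N : ℕ}
    (hdet : Associated c.det (ϖ ^ (n * N))) :
    ∃ u : Matrix (Fin n) (Fin n) R, c = ϖ ^ N • u := by
  have hϖN : ϖ ^ (n * N) ≠ 0 := pow_ne_zero _ hϖ.ne_zero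
  obtain ⟨E, u, hu, hE⟩ := exists_smul_eq_pow_mul b hϖ hβ hπ hZ hQ hQQ hQZ
  obtain ⟨j, w, hw, rfl⟩ := exists_eq_pow_mul_of_intertwines b hϖ hβ hπ hZ hQ hQQ hQZ hc
    (hdet.symm.ne_zero_iff.1 hϖN)
  have hEN : Q ^ (E * N) = ϖ ^ N • u ^ N := by rw [pow_mul, hE, smul_pow]
  have h1 : Associated (Q.det ^ j) (Q.det ^ (E * N)) := by
    have h2 : Associated (Q.det ^ j) (ϖ ^ (n * N)) := by
      refine Associated.trans ?_ hdet
      rw [det_mul, det_pow]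
      exact (associated_mul_unit_right _ _ hw)
    refine h2.trans ?_
    rw [← det_pow, hEN, det_smul, det_pow, Fintype.card_fin, ← pow_mul, mul_comm n N]
    exact associated_mul_unit_right _ _ (hu.pow N)
  -- The determinants of `Q ^ j` and `Q ^ (E * N)` are associated, while `det Q` is a nonzero
  -- nonunit.
  have hj : E * N ≤ j :=
    (pow_dvd_pow_iff (det_ne_zero_of_mul_eq_smul hϖ hQQ)
      (not_isUnit_det_of_uniformizer b hϖ hπ hQ)).1 h1.symm.dvd
  obtain ⟨d, rfl⟩ := Nat.exists_eq_add_of_le hj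
  exact ⟨u ^ N * (Q ^ d * w), by rw [pow_add, hEN, mul_assoc, Matrix.smul_mul]⟩

/-- A primitive matrix whose column lattice is stable under `Z` divides `ϖ`. -/
theorem exists_mul_eq_smul_one_of_intertwines (b : Module.Basis (Fin n) R S) {ϖ : R}
    (hϖ : Irreducible ϖ)
    {β : S} (hβ : Algebra.adjoin R {β} = ⊤) {π : S}
    (hπ : IsLocalRing.maximalIdeal S = Ideal.span {π})
    {Z Y Q Q' X : Matrix (Fin n) (Fin n) R} (hZ : Z = Algebra.leftMulMatrix b β + ϖ • Y)
    (hQ : Q = Algebra.leftMulMatrix b π + ϖ • X) (hQQ : Q * Q' = ϖ • 1) (hQZ : Q * Z = Z * Q)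
    {c W : Matrix (Fin n) (Fin n) R} (hc : Z * c = c * W)
    (hdet : c.det ≠ 0) (hprim : ∀ d, c ≠ ϖ • d) :
    ∃ d, c * d = ϖ • 1 := by
  obtain ⟨E, u, hu, hE⟩ := exists_smul_eq_pow_mul b hϖ hβ hπ hZ hQ hQQ hQZ
  obtain ⟨j, w, hw, rfl⟩ := exists_eq_pow_mul_of_intertwines b hϖ hβ hπ hZ hQ hQQ hQZ hc hdet
  rcases le_total E j with h | h
  · obtain ⟨d, rfl⟩ := Nat.exists_eq_add_of_le h
    exact absurd (by rw [pow_add, hE, mul_assoc, Matrix.smul_mul]) (hprim (u * (Q ^ d * w)))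
  · obtain ⟨d, rfl⟩ := Nat.exists_eq_add_of_le h
    refine ⟨w⁻¹ * (Q ^ d * u⁻¹), ?_⟩
    rw [mul_assoc, ← mul_assoc w, Matrix.mul_nonsing_inv _ hw, one_mul, ← mul_assoc, ← pow_add,
      hE, Matrix.smul_mul, Matrix.mul_nonsing_inv _ hu]

end Lattice

/-! ### Uniformizers as polynomials in a perturbed generator -/

theorem exists_aeval_add_smul {R A : Type*} [CommRing R] [Ring A] [Algebra R A] {a : R}
    {B Z Y : A} (hZ : Z = B + a • Y) (P : Polynomial R) :
    ∃ X, Polynomial.aeval Z P = Polynomial.aeval B P + a • X := by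
  induction P using Polynomial.induction_on with
  | C c => exact ⟨0, by simp⟩
  | add p q hp hq =>
    obtain ⟨X₁, h₁⟩ := hp
    obtain ⟨X₂, h₂⟩ := hq
    exact ⟨X₁ + X₂, by rw [map_add, map_add, h₁, h₂, smul_add]; abel⟩
  | monomial k c ih =>
    obtain ⟨X, h⟩ := ih
    refine ⟨X * Z + Polynomial.aeval B (Polynomial.C c * Polynomial.X ^ k) * Y, ?_⟩
    rw [pow_succ, ← mul_assoc, map_mul, map_mul _ _ Polynomial.X, Polynomial.aeval_X,
      Polynomial.aeval_X, h, add_mul, smul_mul_assoc, smul_add]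
    nth_rewrite 1 [hZ]
    rw [mul_add, mul_smul_comm]
    abel

section Uniformizer

variable {R S : Type*} [CommRing R] [IsDomain R] [IsDiscreteValuationRing R] [CommRing S]
  [IsLocalRing S] [IsDedekindDomain S] [Algebra R S] {n : ℕ}

/-- If `ϖ` is a uniformizer of `S`, the scalar `ϖ` serves as `Q`. Otherwise write `ϖ = π π'` with `π
= P(β)` and `π' = P'(β)`, and take `Q = P(Z)`, which commutes with `Z`. Then `P(Z) P'(Z)` is `ϖ`
times a matrix congruent to 1 modulo `ϖ`, provided the perturbation is divisible by `ϖ²`. -/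
theorem exists_uniformizer_matrix (b : Module.Basis (Fin n) R S) {ϖ : R} (hϖ : Irreducible ϖ)
    {β : S} (hβ : Algebra.adjoin R {β} = ⊤) {r : ℕ}
    (hr : 2 * (IsLocalRing.maximalIdeal S).ramificationIdx R ≤ r)
    {Z Y : Matrix (Fin n) (Fin n) R} (hZ : Z = Algebra.leftMulMatrix b β + ϖ ^ (r / 2) • Y) :
    ∃ (π : S) (Q Q' X : Matrix (Fin n) (Fin n) R),
      IsLocalRing.maximalIdeal S = Ideal.span {π} ∧
      Q = Algebra.leftMulMatrix b π + ϖ • X ∧ Q * Q' = ϖ • 1 ∧ Q * Z = Z * Q := by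
  have : Module.Finite R S := .of_basis b
  have : Module.Free R S := .of_basis b
  have hinj : Function.Injective (algebraMap R S) := FaithfulSMul.algebraMap_injective R S
  have hp0 : IsLocalRing.maximalIdeal R ≠ ⊥ := IsDiscreteValuationRing.not_a_field R
  have hover : (IsLocalRing.maximalIdeal S).LiesOver (IsLocalRing.maximalIdeal R) :=
    ⟨(IsLocalRing.eq_maximalIdeal inferInstance).symm⟩
  have hmap : (IsLocalRing.maximalIdeal R).map (algebraMap R S) =
      Ideal.span {algebraMap R S ϖ} := by
    rw [hϖ.maximalIdeal_eq, Ideal.map_span, Set.image_singleton]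
  have hle : (IsLocalRing.maximalIdeal R).map (algebraMap R S) ≤ IsLocalRing.maximalIdeal S :=
    Ideal.map_le_of_le_comap hover.over.le
  obtain ⟨π, hπ⟩ : ∃ π, IsLocalRing.maximalIdeal S = Ideal.span {π} :=
    (IsPrincipalIdealRing.of_finite_maximals <|
      (Set.finite_singleton (IsLocalRing.maximalIdeal S)).subset fun _ hI =>
        IsLocalRing.eq_maximalIdeal hI).principal _ |>.principal
  have hπϖ : π ∣ algebraMap R S ϖ := by
    rw [← Ideal.mem_span_singleton, ← hπ]
    exact hle (hmap ▸ Ideal.mem_span_singleton_self _)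
  obtain ⟨π', hπ'⟩ := hπϖ
  by_cases hu : IsUnit π'
  · refine ⟨algebraMap R S ϖ, ϖ • 1, 1, 0, ?_, ?_, by simp, by simp⟩
    · rw [hπ, hπ', Ideal.span_singleton_mul_right_unit hu]
    · rw [AlgHom.commutes, smul_zero, add_zero, Algebra.algebraMap_eq_smul_one]
  · have he : (IsLocalRing.maximalIdeal S).ramificationIdx R ≠ 1 := by
      rw [← Ideal.ramificationIdx'_eq_ramificationIdx (IsLocalRing.maximalIdeal R) _ hp0,
        Ideal.ramificationIdx'_ne_one_iff hle, hmap, Ideal.span_singleton_le_iff_mem, sq, hπ']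
      refine Ideal.mul_mem_mul ?_ ?_
      · rw [hπ]; exact Ideal.mem_span_singleton_self _
      · exact (IsLocalRing.mem_maximalIdeal _).2 hu
    have hpos := Ideal.ramificationIdx_pos (IsLocalRing.maximalIdeal S) R
    -- Here the ramification index is at least 2, hence `r ≥ 4`. One factor `ϖ` is divided out below
    -- and the other keeps the cofactor invertible.
    obtain ⟨s, hs⟩ : ∃ s, r / 2 = s + 2 := Nat.exists_eq_add_of_le' (by omega)
    have hpoly : ∀ x : S, ∃ P : Polynomial R, Polynomial.aeval β P = x := by
      intro x
      have hx : x ∈ Algebra.adjoin R {β} := hβ ▸ trivial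
      rw [Algebra.adjoin_singleton_eq_range_aeval] at hx
      exact hx
    obtain ⟨P, hP⟩ := hpoly π
    obtain ⟨P', hP'⟩ := hpoly π'
    have hB : ∀ T : Polynomial R, Polynomial.aeval (Algebra.leftMulMatrix b β) T =
        Algebra.leftMulMatrix b (Polynomial.aeval β T) := fun T =>
      Polynomial.aeval_algHom_apply _ _ _
    obtain ⟨X, hX⟩ := exists_aeval_add_smul hZ P
    obtain ⟨T, hT⟩ := exists_aeval_add_smul hZ (P * P')
    have h1 : Polynomial.aeval Z P * Polynomial.aeval Z P' =
        ϖ • (1 + ϖ • (ϖ ^ s • T)) := by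
      rw [← map_mul, hT, hB, map_mul, hP, hP', ← hπ', AlgHom.commutes,
        Algebra.algebraMap_eq_smul_one, smul_add, smul_smul, smul_smul, hs]
      congr 2
      ring
    have h2 : IsUnit (1 + ϖ • (ϖ ^ s • T)).det :=
      isUnit_det_of_residue_eq hϖ (A := 1) (Y := -(ϖ ^ s • T)) (by simp) (by simp)
    refine ⟨π, Polynomial.aeval Z P, Polynomial.aeval Z P' * (1 + ϖ • (ϖ ^ s • T))⁻¹,
      ϖ ^ (s + 1) • X, hπ, ?_, ?_, ?_⟩
    · rw [hX, hB, hP, hs, smul_smul, ← pow_succ']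
    · rw [← mul_assoc, h1, Matrix.smul_mul, Matrix.mul_nonsing_inv _ h2]
    · have := (Polynomial.commute_X P).map (Polynomial.aeval Z)
      rw [Polynomial.aeval_X] at this
      exact this.eq.symm

theorem exists_eq_smul_unit_of_generator (b : Module.Basis (Fin n) R S) {ϖ : R}
    (hϖ : Irreducible ϖ) {β : S} (hβ : Algebra.adjoin R {β} = ⊤) {r : ℕ} (hr2 : 2 ≤ r)
    (hr : 2 * (IsLocalRing.maximalIdeal S).ramificationIdx R ≤ r)
    {Z Y : Matrix (Fin n) (Fin n) R} (hZ : Z = Algebra.leftMulMatrix b β + ϖ ^ (r / 2) • Y)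
    {c W : Matrix (Fin n) (Fin n) R} (hc : Z * c = c * W) {N : ℕ}
    (hdet : Associated c.det (ϖ ^ (n * N))) :
    ∃ u : Matrix (Fin n) (Fin n) R, c = ϖ ^ N • u := by
  obtain ⟨π, Q, Q', X, hπ, hQ, hQQ, hQZ⟩ := exists_uniformizer_matrix b hϖ hβ hr hZ
  -- Once `Q` is available, only `Z ≡ β` modulo `ϖ` matters.
  refine exists_eq_smul_unit_of_intertwines b hϖ hβ hπ (Y := ϖ ^ (r / 2 - 1) • Y) ?_ hQ hQQ hQZ
    hc hdet
  rw [hZ, smul_smul, ← pow_succ', show r / 2 - 1 + 1 = r / 2 by omega]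

theorem exists_mul_eq_smul_one_of_generator (b : Module.Basis (Fin n) R S) {ϖ : R}
    (hϖ : Irreducible ϖ) {β : S} (hβ : Algebra.adjoin R {β} = ⊤) {r : ℕ} (hr2 : 2 ≤ r)
    (hr : 2 * (IsLocalRing.maximalIdeal S).ramificationIdx R ≤ r)
    {Z Y : Matrix (Fin n) (Fin n) R} (hZ : Z = Algebra.leftMulMatrix b β + ϖ ^ (r / 2) • Y)
    {c W : Matrix (Fin n) (Fin n) R} (hc : Z * c = c * W)
    (hdet : c.det ≠ 0) (hprim : ∀ d, c ≠ ϖ • d) :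
    ∃ d, c * d = ϖ • 1 := by
  obtain ⟨π, Q, Q', X, hπ, hQ, hQQ, hQZ⟩ := exists_uniformizer_matrix b hϖ hβ hr hZ
  refine exists_mul_eq_smul_one_of_intertwines b hϖ hβ hπ (Y := ϖ ^ (r / 2 - 1) • Y) ?_ hQ hQQ
    hQZ hc hdet hprim
  rw [hZ, smul_smul, ← pow_succ', show r / 2 - 1 + 1 = r / 2 by omega]

end Uniformizer

theorem isDedekindDomain_integralClosure {F : Type*} [Field F] [ValuativeRel F]
    [TopologicalSpace F] [IsNonarchimedeanLocalField F] {K : Type*} [Field K] [Algebra F K]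
    [FiniteDimensional F K] {n : ℕ} (b : Module.Basis (Fin n) 𝒪[F] (integralClosure 𝒪[F] K)) :
    IsDedekindDomain (integralClosure 𝒪[F] K) := by
  have : Module.Finite 𝒪[F] (integralClosure 𝒪[F] K) := .of_basis b
  have : IsIntegrallyClosed (integralClosure 𝒪[F] K) :=
    integralClosure.isIntegrallyClosedOfFiniteExtension F
  have : IsNoetherianRing (integralClosure 𝒪[F] K) := IsNoetherianRing.of_finite 𝒪[F] _
  have : Ring.DimensionLEOne (integralClosure 𝒪[F] K) := inferInstance
  exact {}

theorem finiteDimensional_of_basis_integralClosure {F : Type*} [Field F] [ValuativeRel F]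
    [TopologicalSpace F] [IsNonarchimedeanLocalField F] {K : Type*} [Field K] [Algebra F K]
    {n : ℕ} (hn : Module.finrank F K = n)
    (b : Module.Basis (Fin n) 𝒪[F] (integralClosure 𝒪[F] K)) :
    FiniteDimensional F K := by
  refine FiniteDimensional.of_finrank_pos ?_
  rw [hn, Nat.pos_iff_ne_zero]
  -- The value 0 of `finrank` would include infinite extensions; it is excluded because a basis
  -- indexed by `Fin 0` would make `O_K` trivial.
  rintro rfl
  exact not_subsingleton (integralClosure 𝒪[F] K) b.repr.injective.subsingleton

/-! ### Constraints on the elementary divisors of g -/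

section Conjugate

variable {R S : Type*} [CommRing R] [IsDomain R] [IsDiscreteValuationRing R] [CommRing S]
  [IsLocalRing S] [IsDedekindDomain S] [Algebra R S] {n : ℕ}

theorem exists_eq_smul_unit_of_conj (b : Module.Basis (Fin n) R S) {ϖ : R}
    (hϖ : Irreducible ϖ) {β : S} (hβ : Algebra.adjoin R {β} = ⊤) {r : ℕ} (hr2 : 2 ≤ r)
    (hr : 2 * (IsLocalRing.maximalIdeal S).ramificationIdx R ≤ r)
    {κ Z Y : Matrix (Fin n) (Fin n) R} (hκ : IsUnit κ.det)
    (hZ : Z = κ * Algebra.leftMulMatrix b β * κ⁻¹ + ϖ ^ (r / 2) • Y)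
    {c W : Matrix (Fin n) (Fin n) R} (hc : Z * c = c * W) {N : ℕ}
    (hdet : Associated c.det (ϖ ^ (n * N))) :
    ∃ u : Matrix (Fin n) (Fin n) R, c = ϖ ^ N • u := by
  obtain ⟨u, hu⟩ := exists_eq_smul_unit_of_generator b hϖ hβ hr2 hr (Z := κ⁻¹ * Z * κ)
    (Y := κ⁻¹ * Y * κ) (c := κ⁻¹ * c) (W := W) (N := N)
    (by
      rw [hZ, mul_add, add_mul, ← mul_assoc, ← mul_assoc, Matrix.nonsing_inv_mul _ hκ, one_mul,
        mul_assoc, Matrix.nonsing_inv_mul _ hκ, mul_one, Matrix.mul_smul, Matrix.smul_mul])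
    (by
      rw [mul_assoc (κ⁻¹ * Z), ← mul_assoc κ, Matrix.mul_nonsing_inv _ hκ, one_mul, mul_assoc, hc,
        mul_assoc])
    (by
      rw [det_mul]
      exact (associated_unit_mul_left _ _ (by simpa using hκ)).trans hdet)
  refine ⟨κ * u, ?_⟩
  rw [← Matrix.mul_smul, ← hu, ← mul_assoc, Matrix.mul_nonsing_inv _ hκ, one_mul]

theorem exists_mul_eq_smul_one_of_conj (b : Module.Basis (Fin n) R S) {ϖ : R}
    (hϖ : Irreducible ϖ) {β : S} (hβ : Algebra.adjoin R {β} = ⊤) {r : ℕ} (hr2 : 2 ≤ r)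
    (hr : 2 * (IsLocalRing.maximalIdeal S).ramificationIdx R ≤ r)
    {κ Z Y : Matrix (Fin n) (Fin n) R} (hκ : IsUnit κ.det)
    (hZ : Z = κ * Algebra.leftMulMatrix b β * κ⁻¹ + ϖ ^ (r / 2) • Y)
    {c W : Matrix (Fin n) (Fin n) R} (hc : Z * c = c * W)
    (hdet : c.det ≠ 0) (hprim : ∀ d, c ≠ ϖ • d) :
    ∃ d, c * d = ϖ • 1 := by
  obtain ⟨d, hd⟩ := exists_mul_eq_smul_one_of_generator b hϖ hβ hr2 hr (Z := κ⁻¹ * Z * κ)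
    (Y := κ⁻¹ * Y * κ) (c := κ⁻¹ * c) (W := W)
    (by
      rw [hZ, mul_add, add_mul, ← mul_assoc, ← mul_assoc, Matrix.nonsing_inv_mul _ hκ, one_mul,
        mul_assoc, Matrix.nonsing_inv_mul _ hκ, mul_one, Matrix.mul_smul, Matrix.smul_mul])
    (by
      rw [mul_assoc (κ⁻¹ * Z), ← mul_assoc κ, Matrix.mul_nonsing_inv _ hκ, one_mul, mul_assoc, hc,
        mul_assoc])
    (by
      rw [det_mul]
      exact mul_ne_zero (IsUnit.ne_zero (by simpa using hκ)) hdet)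
    (by
      intro d hd
      refine hprim (κ * d) ?_
      rw [← Matrix.mul_smul, ← hd, ← mul_assoc, Matrix.mul_nonsing_inv _ hκ, one_mul])
  refine ⟨d * κ⁻¹, ?_⟩
  have h1 : c * d = ϖ • κ := by
    have := congrArg (κ * ·) hd
    simpa only [← mul_assoc, Matrix.mul_nonsing_inv _ hκ, one_mul, Matrix.mul_smul,
      mul_one] using this
  rw [← mul_assoc, h1, Matrix.smul_mul, Matrix.mul_nonsing_inv _ hκ]

/-- If the entries of a conjugate `B` of the matrix of `β` satisfy the divisibilities imposed by the
cocharacter `v`, then `v = 0`. -/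
theorem eq_zero_of_forall_dvd_conj (b : Module.Basis (Fin n) R S) {ϖ : R}
    (hϖ : Irreducible ϖ) {β : S} (hβ : Algebra.adjoin R {β} = ⊤) {r : ℕ} (hr2 : 2 ≤ r)
    (hr : 2 * (IsLocalRing.maximalIdeal S).ramificationIdx R ≤ r)
    {κ : Matrix (Fin n) (Fin n) R} (hκ : IsUnit κ.det) {v : Fin n → ℤ} (hv : ∑ i, v i = 0)
    (h : ∀ i j, i ≠ j → ∀ t : ℕ, (r : ℤ) ≤ ((r + 1) / 2 : ℕ) + t + v j - v i →
      ϖ ^ (r / 2) ∣ ϖ ^ t * (κ * Algebra.leftMulMatrix b β * κ⁻¹) j i) :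
    v = 0 := by
  classical
  set B := κ * Algebra.leftMulMatrix b β * κ⁻¹ with hB
  -- This is l' = ⌊r/2⌋. Since r = ⌈r/2⌉ + l', the condition in `h` reads `l' ≤ t + v j - v i`.
  set l := r / 2 with hl
  obtain ⟨N, hN⟩ : ∃ N : ℕ, ∀ i, 0 ≤ v i + N := by
    refine ⟨∑ i, (v i).natAbs, fun i => ?_⟩
    have : (v i).natAbs ≤ ∑ i, (v i).natAbs :=
      Finset.single_le_sum (f := fun i => (v i).natAbs) (fun _ _ => Nat.zero_le _)
        (Finset.mem_univ i)
    omega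
  have h1 : ∀ j i, (l : ℤ) ≤ v j - v i → ϖ ^ l ∣ B j i := by
    intro j i hij
    have hne : i ≠ j := by rintro rfl; omega
    simpa using h i j hne 0 (by omega)
  have h2 : ∀ j i, ∀ d : ℕ, (d : ℤ) = v j - v i → d < l → ϖ ^ d ∣ B j i := by
    intro j i d hd hdl
    rcases eq_or_ne i j with rfl | hne
    · simp [show d = 0 by omega]
    have := h i j hne (l - d) (by omega)
    rw [show ϖ ^ l = ϖ ^ (l - d) * ϖ ^ d by rw [← pow_add]; congr 1; omega] at this
    exact (mul_dvd_mul_iff_left (pow_ne_zero _ hϖ.ne_zero)).1 this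
  -- The perturbation `Z` of `B` sets to zero the entries already divisible by `ϖ ^ l`. The
  -- remaining entries are divisible by `ϖ ^ (v j - v i)` whenever this exponent is nonnegative, so
  -- `Z` stabilizes the lattice of the diagonal matrix.
  have hY : ∀ j i, ∃ y, (if (l : ℤ) ≤ v j - v i then 0 else B j i) = B j i + ϖ ^ l * y := by
    intro j i
    split_ifs with hij
    · obtain ⟨y, hy⟩ := h1 j i hij
      exact ⟨-y, by rw [hy]; ring⟩
    · exact ⟨0, by simp⟩
  choose Y hY using hY
  have hW : ∀ j i, ∃ w, (if (l : ℤ) ≤ v j - v i then 0 else B j i) * ϖ ^ (v i + N).toNat =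
      ϖ ^ (v j + N).toNat * w := by
    intro j i
    split_ifs with hij
    · exact ⟨0, by simp⟩
    have hNi := hN i
    have hNj := hN j
    rcases le_total (v j) (v i) with hle | hle
    · refine ⟨ϖ ^ (v i - v j).toNat * B j i, ?_⟩
      rw [show (v i + N).toNat = (v j + N).toNat + (v i - v j).toNat by omega, pow_add]
      ring
    · obtain ⟨y, hy⟩ := h2 j i (v j - v i).toNat (by omega) (by omega)
      refine ⟨y, ?_⟩
      rw [show (v j + N).toNat = (v i + N).toNat + (v j - v i).toNat by omega, pow_add, hy]
      ring
  choose W hW using hW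
  obtain ⟨u, hu⟩ := exists_eq_smul_unit_of_conj b hϖ hβ hr2 hr hκ
    (Z := Matrix.of fun j i => if (l : ℤ) ≤ v j - v i then 0 else B j i) (Y := Matrix.of Y)
    (c := diagonal fun i => ϖ ^ (v i + N).toNat) (W := Matrix.of W) (N := N)
    (by ext j i; exact hY j i) (by ext j i; simp [hW])
    (by
      rw [det_diagonal, Finset.prod_pow_eq_pow_sum]
      have : ∑ i, (v i + N).toNat = n * N := by
        zify
        simp_rw [Int.toNat_of_nonneg (hN _)]
        simp [Finset.sum_add_distrib, hv]
      rw [this])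
  -- The diagonal matrix is divisible by `ϖ ^ N`, which undoes the shift by `N`.
  have hv0 : ∀ i, 0 ≤ v i := by
    intro i
    have h3 := congrFun (congrFun hu i) i
    simp only [diagonal_apply_eq, Matrix.smul_apply, smul_eq_mul] at h3
    have h4 : N ≤ (v i + N).toNat := (pow_dvd_pow_iff hϖ.ne_zero hϖ.not_isUnit).1 ⟨_, h3⟩
    have := hN i
    omega
  ext i
  exact (Finset.sum_eq_zero_iff_of_nonneg fun i _ => hv0 i).1 hv i (Finset.mem_univ i)

/-- Pigeonhole: above `v i` there are `n` disjoint windows of `d + 1` consecutive integers, with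
starting points at most `v j`. If each contained a value of `v`, all `n` indices would be used up,
including `i`, whose value lies below every window. -/
theorem exists_gap {v : Fin n → ℤ} {d : ℕ} {i j : Fin n} (h : v i + n * (d + 1) < v j) :
    ∃ θ : ℤ, v i < θ ∧ θ ≤ v j ∧ ∀ k, θ ≤ v k → θ + d < v k := by
  by_contra! hcon
  have key : ∀ a : Fin n, ∃ k, v i + 1 + a * (d + 1) ≤ v k ∧
      v k ≤ v i + 1 + a * (d + 1) + d := by
    intro a
    refine hcon _ (by nlinarith) ?_
    have : ((a : ℕ) : ℤ) + 1 ≤ n := by exact_mod_cast a.2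
    nlinarith
  choose f hf₁ hf₂ using key
  have hinj : Function.Injective f := by
    intro a a' haa
    have h1 := hf₁ a
    have h2 := hf₂ a
    have h3 := hf₁ a'
    have h4 := hf₂ a'
    rw [haa] at h1 h2
    have h5 : ((a : ℕ) : ℤ) < a' + 1 := by
      by_contra! hlt
      nlinarith
    have h6 : ((a' : ℕ) : ℤ) < a + 1 := by
      by_contra! hlt
      nlinarith
    ext
    omega
  obtain ⟨a, ha⟩ := Finite.surjective_of_injective hinj i
  have := hf₁ a
  rw [ha] at this
  nlinarith

/-- A spread that is too large leaves a gap longer than `m`. Entries of `B` from below the gap to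
above it vanish modulo `ϖ ^ (r / 2)`, so a perturbation of `B` is block triangular. It stabilizes
the lattice of a diagonal matrix with entries 1 and `ϖ ^ 2`, which is primitive and hence would
divide `ϖ`. -/
theorem sub_le_of_forall_dvd_conj (b : Module.Basis (Fin n) R S) {ϖ : R}
    (hϖ : Irreducible ϖ) {β : S} (hβ : Algebra.adjoin R {β} = ⊤) {r : ℕ} (hr2 : 2 ≤ r)
    (hr : 2 * (IsLocalRing.maximalIdeal S).ramificationIdx R ≤ r)
    {κ : Matrix (Fin n) (Fin n) R} (hκ : IsUnit κ.det) {v : Fin n → ℤ} {m : ℕ}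
    (h : ∀ i j, i ≠ j → (m : ℤ) ≤ v j - v i →
      ϖ ^ (r / 2) ∣ (κ * Algebra.leftMulMatrix b β * κ⁻¹) j i) (i j : Fin n) :
    v j ≤ v i + n * (m + 1) := by
  classical
  by_contra! hcon
  set B := κ * Algebra.leftMulMatrix b β * κ⁻¹ with hB
  set l := r / 2 with hl
  obtain ⟨θ, hi, hj, hθ⟩ := exists_gap hcon
  have hY : ∀ j i, ∃ y, (if v i < θ ∧ θ ≤ v j then 0 else B j i) = B j i + ϖ ^ l * y := by
    intro j i
    split_ifs with hij
    · have h1 := hθ j hij.2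
      obtain ⟨y, hy⟩ := h i j (by rintro rfl; omega) (by omega)
      exact ⟨-y, by rw [hy]; ring⟩
    · exact ⟨0, by simp⟩
  choose Y hY using hY
  -- The exponent 2 is what conflicts with divisibility of `ϖ`; exponent 1 would give no
  -- contradiction.
  have hW : ∀ j i, ∃ w, (if v i < θ ∧ θ ≤ v j then 0 else B j i) *
      (if v i < θ then 1 else ϖ ^ 2) = (if v j < θ then 1 else ϖ ^ 2) * w := by
    intro j i
    by_cases h1 : v i < θ <;> by_cases h2 : v j < θ
    · exact ⟨B j i, by simp [h1, h2]⟩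
    · exact ⟨0, by simp [h1, not_lt.1 h2]⟩
    · exact ⟨B j i * ϖ ^ 2, by simp [h1, h2]⟩
    · exact ⟨B j i, by simp [h1, h2, mul_comm]⟩
  choose W hW using hW
  obtain ⟨d, hd⟩ := exists_mul_eq_smul_one_of_conj b hϖ hβ hr2 hr hκ
    (Z := Matrix.of fun j i => if v i < θ ∧ θ ≤ v j then 0 else B j i) (Y := Matrix.of Y)
    (c := diagonal fun i => if v i < θ then 1 else ϖ ^ 2) (W := Matrix.of W)
    (by ext j i; exact hY j i)
    (by ext j i; simp only [mul_diagonal, diagonal_mul, Matrix.of_apply, hW])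
    (by
      rw [det_diagonal, Finset.prod_ne_zero_iff]
      intro k _
      split_ifs
      · exact one_ne_zero
      · exact pow_ne_zero _ hϖ.ne_zero)
    (by
      intro d hd
      have h1 := congrFun (congrFun hd i) i
      simp only [diagonal_apply_eq, if_pos hi, Matrix.smul_apply, smul_eq_mul] at h1
      exact hϖ.not_isUnit (IsUnit.of_mul_eq_one _ h1.symm))
  have h1 := congrFun (congrFun hd j) j
  simp only [diagonal_mul, if_neg (not_lt.2 hj), Matrix.smul_apply, one_apply_eq, smul_eq_mul,
    mul_one] at h1
  refine hϖ.not_isUnit (IsUnit.of_mul_eq_one (d j j) (mul_left_cancel₀ hϖ.ne_zero ?_))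
  linear_combination h1

end Conjugate

/-! ### Cartan decomposition -/

theorem exists_smith_normal_form {R : Type*} [CommRing R] [IsDomain R] [IsDiscreteValuationRing R]
    {ϖ : R} (hϖ : Irreducible ϖ) {n : ℕ} {c : Matrix (Fin n) (Fin n) R} (hc : c.det ≠ 0) :
    ∃ (k₁ k₂ : Matrix (Fin n) (Fin n) R) (a : Fin n → ℕ), IsUnit k₁.det ∧ IsUnit k₂.det ∧
      c = k₁ * diagonal (fun i => ϖ ^ a i) * k₂ := by
  have hinj : Function.Injective c.mulVecLin := by
    rw [← LinearMap.ker_eq_bot, LinearMap.ker_eq_bot']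
    intro y hy
    exact Matrix.eq_zero_of_mulVec_eq_zero hc (by simpa using hy)
  obtain ⟨b', a, ab', hab⟩ := Submodule.exists_smith_normal_form_of_rank_eq (Pi.basisFun R (Fin n))
    (N := LinearMap.range c.mulVecLin) (LinearMap.finrank_range_of_inj hinj)
  let y : Module.Basis (Fin n) R (Fin n → R) := ab'.map (LinearEquiv.ofInjective _ hinj).symm
  have hy : ∀ i, c *ᵥ y i = a i • b' i := by
    intro i
    rw [← hab, ← Matrix.mulVecLin_apply]
    exact congrArg Subtype.val ((LinearEquiv.ofInjective _ hinj).apply_symm_apply (ab' i))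
  have hunit : ∀ z : Module.Basis (Fin n) R (Fin n → R),
      IsUnit ((Pi.basisFun R (Fin n)).toMatrix z).det := fun z =>
    (Matrix.isUnit_iff_isUnit_det _).1
      ⟨⟨_, _, (Pi.basisFun R (Fin n)).toMatrix_mul_toMatrix_flip z,
        z.toMatrix_mul_toMatrix_flip (Pi.basisFun R (Fin n))⟩, rfl⟩
  have hmat : c * (Pi.basisFun R (Fin n)).toMatrix y =
      (Pi.basisFun R (Fin n)).toMatrix b' * diagonal a := by
    ext i j
    rw [mul_diagonal, mul_comm]
    have := congrFun (hy j) i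
    rw [Module.Basis.toMatrix_apply, Pi.basisFun_repr]
    exact this
  have ha : ∀ i, a i ≠ 0 := by
    intro i hi
    have h1 := hy i
    rw [hi, zero_smul] at h1
    exact y.ne_zero i (hinj (by simpa using h1))
  -- The unit parts of the elementary divisors are absorbed into the left factor.
  choose e he using fun i => IsDiscreteValuationRing.associated_pow_irreducible (ha i) hϖ
  choose w hw using fun i => (he i).symm
  refine ⟨(Pi.basisFun R (Fin n)).toMatrix b' * diagonal fun i => (w i : R),
    ((Pi.basisFun R (Fin n)).toMatrix y)⁻¹, e, ?_, by simpa using hunit y, ?_⟩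
  · rw [det_mul, det_diagonal]
    exact (hunit b').mul (IsUnit.prod_univ_iff.2 fun i => (w i).isUnit)
  · rw [mul_assoc (Module.Basis.toMatrix _ _), diagonal_mul_diagonal,
      show (fun i => (w i : R) * ϖ ^ e i) = a from funext fun i => by rw [mul_comm, hw], ← hmat,
      mul_assoc, Matrix.mul_nonsing_inv _ (hunit y), mul_one]

/-! ### Powers of a uniformizer and the topology of F -/

section LocalField

variable {F : Type*} [Field F] [ValuativeRel F] [TopologicalSpace F]
  [IsNonarchimedeanLocalField F]

theorem coe_uniformizer_ne_zero {ϖ : 𝒪[F]} (hϖ : Irreducible ϖ) : (ϖ : F) ≠ 0 := by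
  simpa using hϖ.ne_zero

theorem exists_pow_mul_mem_integer {ϖ : 𝒪[F]} (hϖ : Irreducible ϖ) (y : F) :
    ∃ m : ℕ, (ϖ : F) ^ m * y ∈ 𝒪[F] := by
  rcases (valuation F).valuationSubring.mem_or_inv_mem y with h | h
  · exact ⟨0, by rw [pow_zero, one_mul]; exact h⟩
  · rcases eq_or_ne y 0 with rfl | hy
    · exact ⟨0, by simp⟩
    obtain ⟨m, u, hu⟩ := IsDiscreteValuationRing.eq_unit_mul_pow_irreducible
      (x := (⟨y⁻¹, h⟩ : 𝒪[F])) (by simpa [Subtype.ext_iff] using hy) hϖ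
    refine ⟨m, ?_⟩
    have h1 : y⁻¹ = ((u : 𝒪[F]) : F) * (ϖ : F) ^ m := by
      simpa using congrArg Subtype.val hu
    have h2 : (ϖ : F) ^ m * y = ((u⁻¹ : 𝒪[F]ˣ) : 𝒪[F]) := by
      have h3 : ((u : 𝒪[F]) : F) * (((u⁻¹ : 𝒪[F]ˣ) : 𝒪[F]) : F) = 1 := by
        exact_mod_cast congrArg Subtype.val u.mul_inv
      have h4 : ((u : 𝒪[F]) : F) * (ϖ : F) ^ m * y = 1 := by rw [← h1, inv_mul_cancel₀ hy]
      have h5 : ((u : 𝒪[F]) : F) ≠ 0 := left_ne_zero_of_mul_eq_one h3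
      apply mul_left_cancel₀ h5
      rw [h3, ← h4, mul_assoc]
    rw [h2]
    exact Subtype.coe_prop _

theorem exists_pow_mul_mem_of_mem_nhds {ϖ : 𝒪[F]} (hϖ : Irreducible ϖ) {s : Set F}
    (hs : s ∈ nhds (0 : F)) : ∃ m : ℕ, ∀ k, m ≤ k → ∀ x : 𝒪[F], (ϖ : F) ^ k * x ∈ s := by
  obtain ⟨γ, hγ, hsub⟩ := (IsValuativeTopology.hasBasis_nhds_zero' F).mem_iff.mp hs
  obtain ⟨y, rfl⟩ := valuation_surjective γ
  have hy : y ≠ 0 := by simpa using hγ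
  obtain ⟨m, hm⟩ := exists_pow_mul_mem_integer hϖ y⁻¹
  -- The power `m` gives only valuation at most that of `y`; the extra factor `ϖ` makes the
  -- inequality strict.
  refine ⟨m + 1, fun k hk x => hsub ?_⟩
  obtain ⟨d, rfl⟩ := Nat.exists_eq_add_of_le hk
  have h1 : valuation F (ϖ : F) < 1 := by
    refine lt_of_le_of_ne ϖ.2 fun h => hϖ.not_isUnit ?_
    exact (Valuation.integer.integers (valuation F)).isUnit_of_one' h
  have h2 : valuation F ((ϖ : F) ^ m * y⁻¹) ≤ 1 := hm
  have h3 : valuation F ((ϖ : F) ^ d * x) ≤ 1 := (ϖ ^ d * x).2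
  have h4 : (ϖ : F) ^ (m + 1 + d) * x = y * (((ϖ : F) ^ m * y⁻¹) * ((ϖ : F) ^ d * x)) * ϖ := by
    field_simp
    ring
  change valuation F _ < valuation F y
  rw [h4, map_mul, map_mul, map_mul _ (_ * _) (_ * _)]
  have hvy : 0 < valuation F y := zero_lt_iff.2 hγ
  calc valuation F y * (valuation F ((ϖ : F) ^ m * y⁻¹) * valuation F ((ϖ : F) ^ d * x)) *
        valuation F ϖ ≤ valuation F y * (1 * 1) * valuation F ϖ := by gcongr
    _ = valuation F y * valuation F ϖ := by rw [one_mul, mul_one]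
    _ < valuation F y * 1 := by gcongr
    _ = valuation F y := mul_one _

theorem isOpen_integer : IsOpen (𝒪[F] : Set F) :=
  Valuation.isOpen_integer (v := valuation F)

theorem isCompact_integer : IsCompact (𝒪[F] : Set F) :=
  IsNonarchimedeanLocalField.isCompact_closedBall F 1

theorem t1Space_localField : T1Space F := by
  let := IsTopologicalAddGroup.rightUniformSpace F
  have := isUniformAddGroup_of_addCommGroup (G := F)
  infer_instance

/-! ### Congruence subgroups of `SL_n(F)` -/

theorem algebraMap_integer_apply (x : 𝒪[F]) : algebraMap 𝒪[F] F x = x := rfl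

theorem coe_slInclusion {n : ℕ} (k : SpecialLinearGroup (Fin n) 𝒪[F]) :
    (slInclusion F n k : Matrix (Fin n) (Fin n) F) =
      (algebraMap 𝒪[F] F).mapMatrix (k : Matrix (Fin n) (Fin n) 𝒪[F]) := rfl

theorem slInclusion_injective (n : ℕ) : Function.Injective (slInclusion F n) := by
  intro a b h
  ext i j
  exact congrFun (congrFun (congrArg Subtype.val h) i) j

/-- The principal congruence subgroup of level `m` of `SL_n(O_F)`, as a subgroup of `SL_n(F)`. -/
noncomputable def congruenceSubgroup (F : Type*) [Field F] [ValuativeRel F] [TopologicalSpace F]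
    [IsNonarchimedeanLocalField F] (n m : ℕ) : Subgroup (SpecialLinearGroup (Fin n) F) :=
  (slReduction F n m).ker.map (slInclusion F n)

/-- An element of `SL_n(F)` with integral entries, as an element of `SL_n(O_F)`. -/
theorem exists_slInclusion_eq {n : ℕ} {g : SpecialLinearGroup (Fin n) F}
    {c : Matrix (Fin n) (Fin n) 𝒪[F]}
    (h : (g : Matrix (Fin n) (Fin n) F) = (algebraMap 𝒪[F] F).mapMatrix c) :
    ∃ k : SpecialLinearGroup (Fin n) 𝒪[F],
      (k : Matrix (Fin n) (Fin n) 𝒪[F]) = c ∧ slInclusion F n k = g := by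
  have hdet : c.det = 1 := by
    have h1 := g.det_coe
    rw [h, ← RingHom.map_det] at h1
    exact Subtype.val_injective h1
  refine ⟨⟨c, hdet⟩, rfl, ?_⟩
  ext i j
  rw [h]
  rfl

theorem mem_ker_slReduction {n m : ℕ} {ϖ : 𝒪[F]} (hϖ : Irreducible ϖ)
    {k : SpecialLinearGroup (Fin n) 𝒪[F]} :
    k ∈ (slReduction F n m).ker ↔ ∃ X : Matrix (Fin n) (Fin n) 𝒪[F],
      (k : Matrix (Fin n) (Fin n) 𝒪[F]) = 1 + ϖ ^ m • X := by
  rw [MonoidHom.mem_ker]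
  have key : slReduction F n m k = 1 ↔ ∀ i j, ϖ ^ m ∣
      k i j - (1 : Matrix (Fin n) (Fin n) 𝒪[F]) i j := by
    have hext : slReduction F n m k = 1 ↔ ∀ i j, slReduction F n m k i j =
        (1 : Matrix (Fin n) (Fin n) (𝒪[F] ⧸ 𝓂[F] ^ m)) i j :=
      ⟨fun h i j => by rw [h]; rfl, fun h => by ext i j; exact h i j⟩
    rw [hext]
    refine forall_congr' fun i => forall_congr' fun j => ?_
    rw [← Ideal.mem_span_singleton, ← Ideal.span_singleton_pow, ← hϖ.maximalIdeal_eq,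
      ← Ideal.Quotient.eq]
    refine Eq.congr rfl ?_
    rw [Matrix.one_apply, Matrix.one_apply]
    split_ifs <;> simp
  rw [key]
  constructor
  · intro h
    choose X hX using h
    refine ⟨Matrix.of X, ?_⟩
    ext i j
    simp [← hX]
  · rintro ⟨X, hX⟩ i j
    rw [hX]
    simp

theorem mem_congruenceSubgroup {n m : ℕ} {ϖ : 𝒪[F]} (hϖ : Irreducible ϖ)
    {g : SpecialLinearGroup (Fin n) F} :
    g ∈ congruenceSubgroup F n m ↔ ∃ X : Matrix (Fin n) (Fin n) 𝒪[F],
      (g : Matrix (Fin n) (Fin n) F) = (algebraMap 𝒪[F] F).mapMatrix (1 + ϖ ^ m • X) := by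
  constructor
  · rintro ⟨k, hk, rfl⟩
    obtain ⟨X, hX⟩ := (mem_ker_slReduction hϖ).1 hk
    exact ⟨X, by rw [coe_slInclusion, hX]⟩
  · rintro ⟨X, hX⟩
    obtain ⟨k, hk, rfl⟩ := exists_slInclusion_eq hX
    exact ⟨k, (mem_ker_slReduction hϖ).2 ⟨X, hk⟩, rfl⟩

theorem isCompact_setOf_pow_mul_mem {ϖ : 𝒪[F]} (hϖ : Irreducible ϖ) (n N : ℕ) :
    IsCompact {g : SpecialLinearGroup (Fin n) F | ∀ i j, (ϖ : F) ^ N * g i j ∈ 𝒪[F]} := by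
  have := t1Space_localField (F := F)
  have h0 := pow_ne_zero N (coe_uniformizer_ne_zero hϖ)
  have hc : IsCompact {x : F | (ϖ : F) ^ N * x ∈ 𝒪[F]} := by
    have h1 : {x : F | (ϖ : F) ^ N * x ∈ 𝒪[F]} =
        (fun x => ((ϖ : F) ^ N)⁻¹ * x) '' (𝒪[F] : Set F) := by
      ext x
      constructor
      · intro hx
        exact ⟨_, hx, inv_mul_cancel_left₀ h0 x⟩
      · rintro ⟨y, hy, rfl⟩
        change (ϖ : F) ^ N * (((ϖ : F) ^ N)⁻¹ * y) ∈ 𝒪[F]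
        rwa [mul_inv_cancel_left₀ h0]
    rw [h1]
    exact isCompact_integer.image (by fun_prop)
  have hpi : IsCompact {A : Matrix (Fin n) (Fin n) F | ∀ i j, (ϖ : F) ^ N * A i j ∈ 𝒪[F]} := by
    have := isCompact_univ_pi fun _ : Fin n => isCompact_univ_pi fun _ : Fin n => hc
    convert! this using 1
    ext A
    exact ⟨fun h i _ j _ => h i j, fun h i j => h i trivial j trivial⟩
  exact SpecialLinearGroup.isClosedEmbedding_val.isCompact_preimage hpi

theorem isOpen_congruenceSubgroup {ϖ : 𝒪[F]} (hϖ : Irreducible ϖ) (n m : ℕ) :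
    IsOpen (congruenceSubgroup F n m : Set (SpecialLinearGroup (Fin n) F)) := by
  have h0 := pow_ne_zero m (coe_uniformizer_ne_zero hϖ)
  have h1 : (congruenceSubgroup F n m : Set (SpecialLinearGroup (Fin n) F)) =
      ⋂ i, ⋂ j, {g | ((ϖ : F) ^ m)⁻¹ * (g i j - (1 : Matrix (Fin n) (Fin n) F) i j) ∈ 𝒪[F]} := by
    ext g
    simp only [SetLike.mem_coe, mem_congruenceSubgroup hϖ, Set.mem_iInter, Set.mem_ofPred_eq]
    constructor
    · rintro ⟨X, hX⟩ i j
      have : g i j - (1 : Matrix (Fin n) (Fin n) F) i j = (ϖ : F) ^ m * (X i j : F) := by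
        rw [hX, map_add, map_one]
        simp [algebraMap_integer_apply]
      rw [this, inv_mul_cancel_left₀ h0]
      exact (X i j).2
    · intro h
      refine ⟨Matrix.of fun i j => ⟨_, h i j⟩, ?_⟩
      rw [map_add, map_one]
      ext i j
      simp [algebraMap_integer_apply, mul_inv_cancel_left₀ h0]
  rw [h1]
  refine isOpen_iInter_of_finite fun i => isOpen_iInter_of_finite fun j => ?_
  have hcont : Continuous fun g : SpecialLinearGroup (Fin n) F =>
      ((ϖ : F) ^ m)⁻¹ * (g i j - (1 : Matrix (Fin n) (Fin n) F) i j) := by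
    have : Continuous fun g : SpecialLinearGroup (Fin n) F => g i j :=
      (continuous_apply j).comp (SpecialLinearGroup.continuous_apply _ continuous_id i)
    fun_prop
  exact isOpen_integer.preimage hcont

theorem isCompact_congruenceSubgroup {ϖ : 𝒪[F]} (hϖ : Irreducible ϖ) (n m : ℕ) :
    IsCompact (congruenceSubgroup F n m : Set (SpecialLinearGroup (Fin n) F)) := by
  refine (isCompact_setOf_pow_mul_mem hϖ n 0).of_isClosed_subset
    (Subgroup.isClosed_of_isOpen _ (isOpen_congruenceSubgroup hϖ n m)) ?_
  rintro _ ⟨k, _, rfl⟩ i j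
  rw [pow_zero, one_mul]
  exact (k i j).2

theorem isCompact_range_slInclusion {ϖ : 𝒪[F]} (hϖ : Irreducible ϖ) (n : ℕ) :
    IsCompact (Set.range (slInclusion F n)) := by
  convert! isCompact_setOf_pow_mul_mem hϖ n 0 using 1
  ext g
  constructor
  · rintro ⟨k, rfl⟩ i j
    rw [pow_zero, one_mul]
    exact (k i j).2
  · intro h
    simp only [pow_zero, one_mul, Set.mem_ofPred_eq] at h
    obtain ⟨k, _, hk⟩ := exists_slInclusion_eq (g := g)
      (c := Matrix.of fun i j => ⟨g i j, h i j⟩) (by ext i j; rfl)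
    exact ⟨k, hk⟩

theorem exists_congruenceSubgroup_le {ϖ : 𝒪[F]} (hϖ : Irreducible ϖ) {n : ℕ}
    {U : Subgroup (SpecialLinearGroup (Fin n) F)}
    (hU : IsOpen (U : Set (SpecialLinearGroup (Fin n) F))) :
    ∃ m, congruenceSubgroup F n m ≤ U := by
  obtain ⟨W, hW, hWU⟩ := isOpen_induced_iff.1 hU
  have h1W : (1 : Matrix (Fin n) (Fin n) F) ∈ W := by
    exact (Set.ext_iff.1 hWU 1).2 U.one_mem
  obtain ⟨u, hu, huW⟩ := isOpen_pi_iff'.1 hW _ h1W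
  have h2 : ∀ i, ∃ w : Fin n → Set F, (∀ j, IsOpen (w j) ∧
      (1 : Matrix (Fin n) (Fin n) F) i j ∈ w j) ∧ Set.univ.pi w ⊆ u i := fun i =>
    isOpen_pi_iff'.1 (hu i).1 _ (hu i).2
  choose w hw hwu using h2
  have h3 : ∀ i j, ∃ m : ℕ, ∀ k, m ≤ k → ∀ x : 𝒪[F],
      (1 : Matrix (Fin n) (Fin n) F) i j + (ϖ : F) ^ k * x ∈ w i j := by
    intro i j
    have hcont : Continuous fun y : F => (1 : Matrix (Fin n) (Fin n) F) i j + y := by fun_prop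
    refine exists_pow_mul_mem_of_mem_nhds hϖ
      (s := {y | (1 : Matrix (Fin n) (Fin n) F) i j + y ∈ w i j}) ?_
    refine ((hw i j).1.preimage hcont).mem_nhds ?_
    simpa using (hw i j).2
  choose m hm using h3
  refine ⟨Finset.univ.sup fun i => Finset.univ.sup (m i), fun g hg => ?_⟩
  obtain ⟨X, hX⟩ := (mem_congruenceSubgroup hϖ).1 hg
  have hgW : (g : Matrix (Fin n) (Fin n) F) ∈ W := by
    refine huW fun i _ => hwu i fun j _ => ?_
    have h4 := hm i j (Finset.univ.sup fun i => Finset.univ.sup (m i))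
      ((Finset.le_sup (f := m i) (Finset.mem_univ j)).trans
        (Finset.le_sup (f := fun i => Finset.univ.sup (m i)) (Finset.mem_univ i))) (X i j)
    rw [hX, map_add, map_one]
    simpa [algebraMap_integer_apply] using h4
  exact (Set.ext_iff.1 hWU g).1 hgW

/-- An arbitrary entrywise lift has determinant congruent to 1, hence a unit because `r ≠ 0`.
Scaling one row by the inverse determinant corrects it without changing the reduction. -/
theorem slReduction_surjective (n : ℕ) {r : ℕ} (hr : r ≠ 0) :
    Function.Surjective (slReduction F n r) := by
  intro A
  rcases n.eq_zero_or_pos with rfl | hn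
  · exact ⟨1, Subsingleton.elim _ _⟩
  have : NeZero n := ⟨hn.ne'⟩
  choose M hM using fun i j => Ideal.Quotient.mk_surjective (A i j)
  have hMA : (Ideal.Quotient.mk (𝓂[F] ^ r)).mapMatrix (Matrix.of M) = A := by
    ext i j
    exact hM i j
  have hdet : Ideal.Quotient.mk (𝓂[F] ^ r) (Matrix.of M).det = 1 := by
    rw [RingHom.map_det, hMA, A.det_coe]
  have hu : IsUnit (Matrix.of M).det := by
    have h1 : (Matrix.of M).det - 1 ∈ 𝓂[F] := by
      refine Ideal.pow_le_self hr ?_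
      rw [← Ideal.Quotient.eq, hdet, map_one]
    by_contra h
    have h2 := (IsLocalRing.mem_maximalIdeal _).2 h
    exact (IsLocalRing.maximalIdeal.isMaximal 𝒪[F]).ne_top
      ((Ideal.eq_top_iff_one _).2 (by simpa using Ideal.sub_mem _ h2 h1))
  obtain ⟨u, hu⟩ := hu
  have huinv : Ideal.Quotient.mk (𝓂[F] ^ r) ((u⁻¹ : 𝒪[F]ˣ) : 𝒪[F]) = 1 := by
    have h1 := congrArg (Ideal.Quotient.mk (𝓂[F] ^ r)) u.inv_mul
    rwa [map_mul, hu, hdet, mul_one, map_one] at h1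
  refine ⟨⟨(Matrix.of M).updateRow 0 (((u⁻¹ : 𝒪[F]ˣ) : 𝒪[F]) • Matrix.of M 0), ?_⟩, ?_⟩
  · rw [det_updateRow_smul, updateRow_eq_self, ← hu, Units.inv_mul]
  · ext i j
    rw [← hMA]
    change Ideal.Quotient.mk (𝓂[F] ^ r) ((Matrix.of M).updateRow 0 _ i j) =
      Ideal.Quotient.mk (𝓂[F] ^ r) (M i j)
    rw [updateRow_apply]
    split_ifs with hi
    · subst hi
      simp [huinv]
    · rfl

/-- The Cartan decomposition. -/
theorem exists_cartan_decomposition {ϖ : 𝒪[F]} (hϖ : Irreducible ϖ) {n : ℕ}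
    (g : SpecialLinearGroup (Fin n) F) :
    ∃ (k₁ k₂ : Matrix (Fin n) (Fin n) 𝒪[F]) (v : Fin n → ℤ), IsUnit k₁.det ∧ IsUnit k₂.det ∧
      ∑ i, v i = 0 ∧
      (g : Matrix (Fin n) (Fin n) F) = (algebraMap 𝒪[F] F).mapMatrix k₁ *
        diagonal (fun i => (ϖ : F) ^ v i) * (algebraMap 𝒪[F] F).mapMatrix k₂ := by
  have h0 := coe_uniformizer_ne_zero hϖ
  choose m hm using fun i j => exists_pow_mul_mem_integer hϖ (g i j)
  let N := Finset.univ.sup fun i => Finset.univ.sup (m i)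
  have hN : ∀ i j, (ϖ : F) ^ N * g i j ∈ 𝒪[F] := by
    intro i j
    obtain ⟨d, hd⟩ := Nat.exists_eq_add_of_le
      ((Finset.le_sup (f := m i) (Finset.mem_univ j)).trans
        (Finset.le_sup (f := fun i => Finset.univ.sup (m i)) (Finset.mem_univ i)))
    rw [show N = m i j + d from hd, pow_add, mul_comm ((ϖ : F) ^ m i j), mul_assoc]
    exact Subring.mul_mem _ (ϖ ^ d).2 (hm i j)
  let c : Matrix (Fin n) (Fin n) 𝒪[F] := Matrix.of fun i j => ⟨_, hN i j⟩
  have hc : (algebraMap 𝒪[F] F).mapMatrix c = (ϖ : F) ^ N • (g : Matrix (Fin n) (Fin n) F) := by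
    ext i j
    rfl
  have hdet : c.det = ϖ ^ (n * N) := by
    apply Subtype.val_injective
    change algebraMap 𝒪[F] F c.det = _
    rw [RingHom.map_det, hc, det_smul, g.det_coe, mul_one, Fintype.card_fin, ← pow_mul, mul_comm]
    rfl
  obtain ⟨k₁, k₂, a, hk₁, hk₂, hca⟩ := exists_smith_normal_form hϖ
    (hdet ▸ pow_ne_zero _ hϖ.ne_zero)
  refine ⟨k₁, k₂, fun i => (a i : ℤ) - N, hk₁, hk₂, ?_, ?_⟩
  · have h1 : Associated (ϖ ^ (n * N)) (ϖ ^ ∑ i, a i) := by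
      rw [← hdet, hca, det_mul, det_mul, det_diagonal, Finset.prod_pow_eq_pow_sum]
      exact (associated_mul_unit_left _ _ hk₂).trans (associated_unit_mul_left _ _ hk₁)
    have h2 : n * N = ∑ i, a i := le_antisymm
      ((pow_dvd_pow_iff hϖ.ne_zero hϖ.not_isUnit).1 h1.dvd)
      ((pow_dvd_pow_iff hϖ.ne_zero hϖ.not_isUnit).1 h1.symm.dvd)
    rw [Finset.sum_sub_distrib, ← Nat.cast_sum, ← h2]
    simp
  · have h1 : (g : Matrix (Fin n) (Fin n) F) =
        ((ϖ : F) ^ N)⁻¹ • (algebraMap 𝒪[F] F).mapMatrix c := by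
      rw [hc, inv_smul_smul₀ (pow_ne_zero _ h0)]
    have h2 : diagonal (fun i => (ϖ : F) ^ ((a i : ℤ) - N)) =
        ((ϖ : F) ^ N)⁻¹ • (algebraMap 𝒪[F] F).mapMatrix (diagonal fun i => ϖ ^ a i) := by
      ext i j
      rcases eq_or_ne i j with rfl | hij
      · simp [zpow_sub₀ h0, div_eq_inv_mul, algebraMap_integer_apply]
      · simp [hij]
    rw [h1, hca, map_mul, map_mul, h2, Matrix.mul_smul, Matrix.smul_mul]

end LocalField

/-! ### Irreducible representations of finite groups -/

section FiniteGroup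

variable {Q V : Type*} [Group Q] [AddCommGroup V] [Module ℂ V] {δ : Representation ℂ Q V}

theorem span_orbit_eq_top (hδ : δ.IsIrreducible) {v : V} (hv : v ≠ 0) :
    Submodule.span ℂ (Set.range fun q => δ q v) = ⊤ := by
  have : IsSimpleOrder (Subrepresentation δ) := hδ
  let T : Subrepresentation δ :=
    { toSubmodule := Submodule.span ℂ (Set.range fun q => δ q v)
      apply_mem_toSubmodule := by
        intro g w hw
        induction hw using Submodule.span_induction with
        | mem w hw =>
          obtain ⟨q, rfl⟩ := hw
          refine Submodule.subset_span ⟨g * q, ?_⟩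
          simp
        | zero => simp
        | add x y _ _ hx hy => rw [map_add]; exact Submodule.add_mem _ hx hy
        | smul a x _ hx => rw [map_smul]; exact Submodule.smul_mem _ a hx }
  have hvT : v ∈ T.toSubmodule := Submodule.subset_span ⟨1, by simp⟩
  rcases IsSimpleOrder.eq_bot_or_eq_top T with h | h
  · rw [h] at hvT
    exact absurd hvT hv
  · exact congrArg Subrepresentation.toSubmodule h

theorem IsIrreducible.finiteDimensional [Finite Q] (hδ : δ.IsIrreducible) :
    FiniteDimensional ℂ V := by
  rcases subsingleton_or_nontrivial V with h | h
  · infer_instance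
  obtain ⟨v, hv⟩ := exists_ne (0 : V)
  exact ⟨Submodule.fg_def.2 ⟨_, Set.finite_range _, span_orbit_eq_top hδ hv⟩⟩

/-- Let e be the sum of the operators of the stabilizer of `v`. It is nonzero because it multiplies
`v` by the order of the stabilizer, so it does not kill some translate of the χ-eigenvector, as
these translates span. That translate transforms under `H` by a conjugate of χ, while e absorbs the
stabilizer; so the conjugate is trivial on the elements of `H` fixing `v`. -/
theorem exists_conj_character_eq_one [Finite Q] (hδ : δ.IsIrreducible) {H : Subgroup Q}
    [hH : H.Normal] {χ : H →* Circle} (hχ : ContainsCharacter δ H χ) {v : V} (hv : v ≠ 0) :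
    ∃ q : Q, ∀ h : H, δ h v = v →
      χ ⟨q⁻¹ * h * q, by simpa using hH.conj_mem h h.2 q⁻¹⟩ = 1 := by
  classical
  obtain ⟨v₀, hv₀, hχ⟩ := hχ
  let S : Subgroup Q :=
    { carrier := {q | δ q v = v}
      one_mem' := by simp
      mul_mem' := fun {a b} ha hb => by
        change δ (a * b) v = v
        rw [map_mul, Module.End.mul_apply, show δ b v = v from hb]
        exact ha
      inv_mem' := fun {a} ha => by
        change δ a⁻¹ v = v
        conv_lhs => rw [← show δ a v = v from ha]
        exact δ.inv_self_apply a v }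
  have := Fintype.ofFinite S
  let e : V →ₗ[ℂ] V := ∑ s : S, δ (s : Q)
  have hev : e v = (Fintype.card S : ℂ) • v := by
    have : ∀ s : S, δ (s : Q) v = v := fun s => s.2
    simp [e, LinearMap.sum_apply, this, Finset.card_univ, Nat.cast_smul_eq_nsmul]
  have heh : ∀ s ∈ S, ∀ w, e (δ s w) = e w := by
    intro s hs w
    simp only [e, LinearMap.sum_apply, ← Module.End.mul_apply, ← map_mul]
    exact Fintype.sum_equiv (Equiv.mulRight ⟨s, hs⟩) _ _ fun _ => rfl
  obtain ⟨q, hq⟩ : ∃ q, e (δ q v₀) ≠ 0 := by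
    by_contra! h
    have h1 : e = 0 := by
      refine LinearMap.ext_on_range (span_orbit_eq_top hδ hv₀) fun q => ?_
      rw [h q, LinearMap.zero_apply]
    rw [h1, LinearMap.zero_apply] at hev
    exact smul_ne_zero (by simp) hv hev.symm
  refine ⟨q, fun h hh => ?_⟩
  have h1 : δ (h : Q) (δ q v₀) =
      (χ ⟨q⁻¹ * h * q, by simpa using hH.conj_mem h h.2 q⁻¹⟩ : ℂ) • δ q v₀ := by
    rw [← map_smul, ← hχ, ← Module.End.mul_apply, ← Module.End.mul_apply, ← map_mul, ← map_mul]
    congr 2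
    group
  have h2 := heh h hh (δ q v₀)
  rw [h1, map_smul] at h2
  have h3 := smul_left_injective ℂ hq (h2.trans (one_smul ℂ _).symm)
  exact Subtype.val_injective h3

end FiniteGroup

/-! ### From fixed vectors to divisibility of matrix entries -/

section FixedVectors

variable {F : Type*} [Field F] [ValuativeRel F] [TopologicalSpace F]
  [IsNonarchimedeanLocalField F]

instance halfKernel_normal (n r : ℕ) : (halfKernel F n r).Normal :=
  inferInstanceAs (MonoidHom.ker _).Normal

theorem slReduction_mem_halfKernel {n r : ℕ} {ϖ : 𝒪[F]} (hϖ : Irreducible ϖ)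
    {k : SpecialLinearGroup (Fin n) 𝒪[F]} {X : Matrix (Fin n) (Fin n) 𝒪[F]}
    (hk : (k : Matrix (Fin n) (Fin n) 𝒪[F]) = 1 + ϖ ^ ((r + 1) / 2) • X) :
    slReduction F n r k ∈ halfKernel F n r := by
  have h1 : slReduction F n ((r + 1) / 2) k = 1 :=
    (mem_ker_slReduction (m := (r + 1) / 2) hϖ).2 ⟨X, hk⟩
  refine MonoidHom.mem_ker.2 (Eq.trans ?_ h1)
  ext i j
  rfl

instance finite_quotient_maximalIdeal_pow (r : ℕ) : Finite (𝒪[F] ⧸ 𝓂[F] ^ r) := by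
  have : Finite (𝒪[F] ⧸ 𝓂[F]) := inferInstanceAs (Finite 𝓀[F])
  exact Ideal.finite_quotient_pow (I := 𝓂[F]) (Ideal.fg_of_isNoetherianRing _) r

instance finite_specialLinearGroup_quotient (n r : ℕ) :
    Finite (SpecialLinearGroup (Fin n) (𝒪[F] ⧸ 𝓂[F] ^ r)) :=
  Finite.of_injective (fun A => (A : Matrix (Fin n) (Fin n) (𝒪[F] ⧸ 𝓂[F] ^ r)))
    Subtype.val_injective

/-- Scaling `X` by all of `O_F` tests τ on a whole fractional ideal, and the conductor condition
then gives integrality. -/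
theorem dvd_of_forall_psiValue_eq_one {n : ℕ} {τ : AddChar F Circle} (hτ : HasConductorO τ)
    {ϖ : 𝒪[F]} (hϖ : Irreducible ϖ) {r : ℕ} {β X : Matrix (Fin n) (Fin n) 𝒪[F]}
    (h : ∀ x : 𝒪[F], psiValue τ ϖ r β (x • X) = 1) : ϖ ^ (r / 2) ∣ (X * β).trace := by
  have h0 := pow_ne_zero (r / 2) (coe_uniformizer_ne_zero hϖ)
  have h1 : ((ϖ : F) ^ (r / 2))⁻¹ * ((X * β).trace : 𝒪[F]) ∈ 𝒪[F] := by
    have : ((ϖ : F) ^ (r / 2))⁻¹ * ((X * β).trace : 𝒪[F]) ∈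
        {x : F | ∀ y : 𝒪[F], τ (x * y) = 1} := by
      intro y
      have h2 := h y
      rw [psiValue, Matrix.smul_mul, trace_smul, smul_eq_mul] at h2
      rw [← h2]
      push_cast
      congr 1
      ring
    rw [hτ] at this
    exact this
  refine ⟨⟨_, h1⟩, Subtype.val_injective ?_⟩
  push_cast
  rw [mul_inv_cancel_left₀ h0]

/-- If a nonzero vector of `δ` is fixed by `SL_n(O_F) ∩ g K_m g⁻¹`, then the entries of a
conjugate of `β` satisfy divisibilities imposed by the elementary divisors of `g`. -/
theorem exists_conj_forall_dvd {n r m : ℕ} {τ : AddChar F Circle} (hτ : HasConductorO τ)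
    {ϖ : 𝒪[F]} (hϖ : Irreducible ϖ) (hr : r ≠ 0) {β : Matrix (Fin n) (Fin n) 𝒪[F]}
    {V : Type*} [AddCommGroup V] [Module ℂ V]
    {δ : Representation ℂ (SpecialLinearGroup (Fin n) (𝒪[F] ⧸ 𝓂[F] ^ r)) V}
    (hδ : δ.IsIrreducible)
    (hδβ : ContainsCharacter δ (halfKernel F n r) (psi τ hτ.apply_eq_one ϖ hϖ r β))
    {g : SpecialLinearGroup (Fin n) F} {k₁ k₂ : Matrix (Fin n) (Fin n) 𝒪[F]} {v : Fin n → ℤ}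
    (hk₁ : IsUnit k₁.det) (hk₂ : IsUnit k₂.det)
    (hg : (g : Matrix (Fin n) (Fin n) F) = (algebraMap 𝒪[F] F).mapMatrix k₁ *
        diagonal (fun i => (ϖ : F) ^ v i) * (algebraMap 𝒪[F] F).mapMatrix k₂)
    {w : V} (hw : w ≠ 0)
    (hfix : ∀ k, g⁻¹ * slInclusion F n k * g ∈ congruenceSubgroup F n m →
      δ (slReduction F n r k) w = w) :
    ∃ κ : Matrix (Fin n) (Fin n) 𝒪[F], IsUnit κ.det ∧ ∀ i j, i ≠ j → ∀ t : ℕ,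
      (m : ℤ) ≤ ((r + 1) / 2 : ℕ) + t + v j - v i →
      ϖ ^ (r / 2) ∣ ϖ ^ t * (κ * β * κ⁻¹) j i := by
  classical
  have h0 := coe_uniformizer_ne_zero hϖ
  set l := (r + 1) / 2 with hl
  obtain ⟨q, hq⟩ := exists_conj_character_eq_one hδ hδβ hw
  obtain ⟨k, rfl⟩ := slReduction_surjective n hr q
  have hkdet : IsUnit (k : Matrix (Fin n) (Fin n) 𝒪[F]).det := by rw [k.det_coe]; exact isUnit_one
  refine ⟨k₁⁻¹ * k, by rw [det_mul]; exact IsUnit.mul (by simpa using hk₁) hkdet,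
    fun i j hij t ht => ?_⟩
  -- Conjugating by `g⁻¹` turns level `l + t` into `l + t + v j - v i`; `s` is the excess over `m`.
  obtain ⟨s, hs⟩ : ∃ s : ℕ, (s : ℤ) = l + t + v j - v i - m :=
    ⟨(l + t + v j - v i - m).toNat, Int.toNat_of_nonneg (by omega)⟩
  -- These are conjugates of transvections, so they have determinant 1 exactly; this is why only `i
  -- ≠ j` is treated.
  have hdet : ∀ x : 𝒪[F], (1 + ϖ ^ l • (x • ϖ ^ t • (k₁ * single i j 1 * k₁⁻¹))).det = 1 := by
    intro x
    have : 1 + ϖ ^ l • (x • ϖ ^ t • (k₁ * single i j 1 * k₁⁻¹)) =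
        k₁ * transvection i j (ϖ ^ l * (x * ϖ ^ t)) * k₁⁻¹ := by
      have hsingle : single i j (ϖ ^ l * (x * ϖ ^ t)) = (ϖ ^ l * (x * ϖ ^ t)) • single i j 1 := by
        rw [smul_single, smul_eq_mul, mul_one]
      rw [transvection, hsingle, mul_add, add_mul, mul_one, Matrix.mul_nonsing_inv _ hk₁,
        Matrix.mul_smul, Matrix.smul_mul, smul_smul x, smul_smul]
    rw [this, det_mul, det_mul, det_transvection_of_ne _ _ hij, mul_one, ← det_mul,
      Matrix.mul_nonsing_inv _ hk₁, det_one]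
  let h : 𝒪[F] → SpecialLinearGroup (Fin n) 𝒪[F] := fun x => ⟨_, hdet x⟩
  have hmem : ∀ x, slReduction F n r (h x) ∈ halfKernel F n r := fun x =>
    slReduction_mem_halfKernel hϖ (X := x • ϖ ^ t • (k₁ * single i j 1 * k₁⁻¹)) rfl
  have hcong : ∀ x, g⁻¹ * slInclusion F n (h x) * g ∈ congruenceSubgroup F n m := by
    intro x
    rw [mem_congruenceSubgroup hϖ]
    refine ⟨(x * ϖ ^ s) • (k₂⁻¹ * single i j 1 * k₂), ?_⟩
    have e1 : (algebraMap 𝒪[F] F).mapMatrix k₁⁻¹ * (algebraMap 𝒪[F] F).mapMatrix k₁ = 1 := by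
      rw [← map_mul, Matrix.nonsing_inv_mul _ hk₁, map_one]
    have e2 : (algebraMap 𝒪[F] F).mapMatrix k₂ * (algebraMap 𝒪[F] F).mapMatrix k₂⁻¹ = 1 := by
      rw [← map_mul, Matrix.mul_nonsing_inv _ hk₂, map_one]
    have e3 : ∀ (a : 𝒪[F]) (M : Matrix (Fin n) (Fin n) 𝒪[F]),
        (algebraMap 𝒪[F] F).mapMatrix (a • M) = (a : F) • (algebraMap 𝒪[F] F).mapMatrix M := by
      intro a M
      ext i j
      simp [algebraMap_integer_apply]
    have e4 : (algebraMap 𝒪[F] F).mapMatrix (single i j (1 : 𝒪[F])) = single i j (1 : F) := by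
      ext a b
      simp [single_apply, apply_ite]
    have e5 : (diagonal fun i => (ϖ : F) ^ v i) * single i j (1 : F) =
        (ϖ : F) ^ v i • single i j 1 := by
      ext a b
      simp only [diagonal_mul, Matrix.smul_apply, single_apply, smul_eq_mul]
      split_ifs with hab
      · rw [hab.1]
      · simp
    have e6 : single i j (1 : F) * (diagonal fun i => (ϖ : F) ^ v i) =
        (ϖ : F) ^ v j • single i j 1 := by
      ext a b
      simp only [mul_diagonal, Matrix.smul_apply, single_apply, smul_eq_mul]
      split_ifs with hab
      · rw [hab.2, mul_comm]
      · simp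
    have e7 : (ϖ : F) ^ m * (x * (ϖ : F) ^ s) * (ϖ : F) ^ v i =
        (ϖ : F) ^ l * (x * (ϖ : F) ^ t) * (ϖ : F) ^ v j := by
      have : (ϖ : F) ^ m * (ϖ : F) ^ s * (ϖ : F) ^ v i =
          (ϖ : F) ^ l * (ϖ : F) ^ t * (ϖ : F) ^ v j := by
        simp only [← zpow_natCast, ← zpow_add₀ h0]
        congr 1
        omega
      linear_combination (x : F) * this
    have key : (slInclusion F n (h x)).1 * g.1 = g.1 * (algebraMap 𝒪[F] F).mapMatrix
          (1 + ϖ ^ m • ((x * ϖ ^ s) • (k₂⁻¹ * single i j 1 * k₂))) := by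
      change (algebraMap 𝒪[F] F).mapMatrix
        (1 + ϖ ^ l • (x • ϖ ^ t • (k₁ * single i j 1 * k₁⁻¹))) * _ = _
      rw [map_add, map_add, map_one, smul_smul x, smul_smul, smul_smul, e3, e3, map_mul, map_mul,
        map_mul, map_mul, add_mul, mul_add, one_mul, mul_one, e4]
      congr 1
      rw [hg]
      simp only [Matrix.smul_mul, Matrix.mul_smul, mul_assoc]
      rw [← mul_assoc ((algebraMap 𝒪[F] F).mapMatrix k₁⁻¹), e1, one_mul,
        ← mul_assoc ((algebraMap 𝒪[F] F).mapMatrix k₂), e2, one_mul,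
        ← mul_assoc (single i j (1 : F)), e6, ← mul_assoc (diagonal _), e5]
      simp only [Matrix.smul_mul, Matrix.mul_smul, smul_smul]
      congr 1
      push_cast
      rw [e7]
    have hgi : (g⁻¹).1 * g.1 = 1 := congrArg Subtype.val (inv_mul_cancel g)
    change (g⁻¹).1 * (slInclusion F n (h x)).1 * g.1 = _
    rw [mul_assoc, key, ← mul_assoc, hgi, one_mul]
  have hdvd : ϖ ^ (r / 2) ∣
      ((ϖ ^ t • (k⁻¹.1 * k₁ * single i j 1 * (k₁⁻¹ * k.1))) * β).trace := by
    refine dvd_of_forall_psiValue_eq_one hτ hϖ fun x => ?_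
    have h1 := hq ⟨_, hmem x⟩ (hfix _ (hcong x))
    rw [← h1]
    refine (psi_apply τ hτ.apply_eq_one ϖ hϖ r β _ _ ?_).symm
    have h2 : 1 + ϖ ^ l • x • ϖ ^ t • (k⁻¹.1 * k₁ * single i j 1 * (k₁⁻¹ * k.1)) =
        (k⁻¹ * h x * k).1 := by
      change _ = k⁻¹.1 * (1 + ϖ ^ l • (x • ϖ ^ t • (k₁ * single i j 1 * k₁⁻¹))) * k.1
      have h3 : k⁻¹.1 * k.1 = 1 := congrArg Subtype.val (inv_mul_cancel k)
      rw [mul_add, add_mul, mul_one, h3]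
      simp only [Matrix.smul_mul, Matrix.mul_smul, mul_assoc]
    rw [h2]
    exact congrArg Subtype.val (show slReduction F n r (k⁻¹ * h x * k) = (slReduction F n r k)⁻¹ *
      slReduction F n r (h x) * slReduction F n r k by rw [map_mul, map_mul, map_inv])
  have hinv : (k₁⁻¹ * k.1)⁻¹ = k⁻¹.1 * k₁ := by
    refine Matrix.inv_eq_left_inv ?_
    rw [mul_assoc, ← mul_assoc k₁, Matrix.mul_nonsing_inv _ hk₁, one_mul]
    exact congrArg Subtype.val (inv_mul_cancel k)
  -- Pairing with the elementary matrix at `(i, j)` extracts the transposed entry `(j, i)` of the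
  -- conjugate of `β`.
  have htr : ((ϖ ^ t • (k⁻¹.1 * k₁ * single i j 1 * (k₁⁻¹ * k.1))) * β).trace =
      ϖ ^ t * ((k₁⁻¹ * k.1) * β * (k₁⁻¹ * k.1)⁻¹) j i := by
    rw [hinv, Matrix.smul_mul, trace_smul, smul_eq_mul]
    congr 1
    rw [mul_assoc (k⁻¹.1 * k₁ * single i j 1), mul_assoc (k⁻¹.1 * k₁), trace_mul_comm, mul_assoc,
      trace_single_mul, one_smul]
  rw [← htr]
  exact hdvd

end FixedVectors

/-! ### Irreducibility and supercuspidality of compactly induced representations -/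

section Average

variable {G W : Type*} [Group G] [TopologicalSpace G] [IsTopologicalGroup G] [AddCommGroup W]
  [Module ℂ W]

/-- Averaging over `U` reduces to a sum over the finite coset space of `U` modulo the part lying in
an open subgroup fixing `w`. The sum is not normalized; its number of terms is nonzero, which lets
nonvanishing survive below. -/
theorem exists_sum_translates_invariant (π : Representation ℂ G W) {U : Subgroup G}
    (hU : IsCompact (U : Set G)) {w : W} (hw : IsSmoothVector π w) :
    ∃ (k : ℕ) (t : Fin k → G), k ≠ 0 ∧ (∀ i, t i ∈ U) ∧
      ∀ u ∈ U, π u (∑ i, π (t i) w) = ∑ i, π (t i) w := by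
  obtain ⟨S, hS, hSw⟩ := hw
  have : CompactSpace U := isCompact_iff_compactSpace.1 hU
  have hfin : Finite (U ⧸ S.subgroupOf U) :=
    Subgroup.quotient_finite_of_isOpen _ (hS.preimage continuous_subtype_val)
  let e := Finite.equivFin (U ⧸ S.subgroupOf U)
  have hstab : ∀ a b : U, (a : U ⧸ S.subgroupOf U) = b → π (a : G) w = π (b : G) w := by
    intro a b hab
    have h1 := QuotientGroup.eq.1 hab
    rw [Subgroup.mem_subgroupOf] at h1
    have h2 := hSw _ h1
    conv_lhs => rw [← h2, ← Module.End.mul_apply, ← map_mul]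
    simp
  refine ⟨Nat.card (U ⧸ S.subgroupOf U), fun i => ((e.symm i).out : U), Nat.card_pos.ne',
    fun i => Subtype.coe_prop _, fun u hu => ?_⟩
  have := Fintype.ofFinite (U ⧸ S.subgroupOf U)
  have key : ∀ u : G, ∑ i, π u (π ((e.symm i).out : U) w) =
      ∑ q : U ⧸ S.subgroupOf U, π u (π (q.out : U) w) := fun u =>
    Fintype.sum_equiv e.symm _ _ fun _ => rfl
  have key1 := key 1
  simp only [map_one, Module.End.one_apply] at key1
  rw [map_sum, key, key1]
  refine Fintype.sum_equiv (MulAction.toPerm (⟨u, hu⟩ : U)) _ _ fun q => ?_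
  rw [← Module.End.mul_apply, ← map_mul]
  refine hstab (⟨u, hu⟩ * q.out) _ ?_
  rw [MulAction.toPerm_apply, QuotientGroup.out_eq', ← smul_eq_mul, ← MulAction.Quotient.smul_coe,
    QuotientGroup.out_eq']

end Average

section CompactInduction

variable {H G V : Type*} [Group H] [Group G] [TopologicalSpace G]
  [IsTopologicalGroup G] [AddCommGroup V] [Module ℂ V]

theorem compactIndV_apply_mul {φ : H →* G} {ρ : Representation ℂ H V} (f : compactIndV φ ρ)
    (h : H) (g : G) : (f : G → V) (φ h * g) = ρ h ((f : G → V) g) := f.2.1 h g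

theorem compactInd_isSmoothRep (φ : H →* G) (ρ : Representation ℂ H V) :
    IsSmoothRep (compactInd φ ρ) := by
  intro f
  obtain ⟨U, hU, h⟩ := f.2.2.1
  exact ⟨U, hU, fun u hu => Subtype.ext (funext fun g => h g u hu)⟩

/-- If `f` is invariant under `U`, then its value at `g` is fixed by `H ∩ g U g⁻¹`. -/
theorem compactIndV_apply_fixed {φ : H →* G} {ρ : Representation ℂ H V} {f : compactIndV φ ρ}
    {U : Subgroup G} (hf : ∀ u ∈ U, compactInd φ ρ u f = f) (g : G) (h : H)
    (hh : g⁻¹ * φ h * g ∈ U) : ρ h ((f : G → V) g) = (f : G → V) g := by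
  rw [← compactIndV_apply_mul]
  have h1 := congrFun (congrArg Subtype.val (hf _ hh)) g
  rw [compactInd_apply] at h1
  rw [← h1]
  group

/-- The function supported on the image of `H` with value `v` at `1`. -/
noncomputable def supportedAtOne (φ : H →* G) (ρ : Representation ℂ H V) (hφ : Function.Injective φ)
    {K : Subgroup H} (hK : ∀ k ∈ K, ρ k = 1) (hKo : IsOpen (K.map φ : Set G)) :
    V →ₗ[ℂ] compactIndV φ ρ where
  toFun v := ⟨Function.extend φ (fun h => ρ h v) 0, by
    refine ⟨fun h g => ?_, ⟨K.map φ, hKo, ?_⟩, {1}, isCompact_singleton, fun g hg => ?_⟩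
    · by_cases hg : ∃ h', φ h' = g
      · obtain ⟨h', rfl⟩ := hg
        rw [← map_mul, hφ.extend_apply, hφ.extend_apply, map_mul, Module.End.mul_apply]
      · rw [Function.extend_apply' _ _ _ hg, Function.extend_apply', Pi.zero_apply, Pi.zero_apply,
          map_zero]
        rintro ⟨h', hh'⟩
        exact hg ⟨h⁻¹ * h', by rw [map_mul, hh', map_inv, inv_mul_cancel_left]⟩
    · rintro g _ ⟨k, hk, rfl⟩
      by_cases hg : ∃ h', φ h' = g
      · obtain ⟨h', rfl⟩ := hg
        rw [← map_mul, hφ.extend_apply, hφ.extend_apply, map_mul, hK k hk, mul_one]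
      · rw [Function.extend_apply' _ _ _ hg, Function.extend_apply', Pi.zero_apply, Pi.zero_apply]
        rintro ⟨h', hh'⟩
        exact hg ⟨h' * k⁻¹, by rw [map_mul, hh', map_inv, mul_inv_cancel_right]⟩
    · by_cases hg' : ∃ h', φ h' = g
      · obtain ⟨h', rfl⟩ := hg'
        exact ⟨h', 1, rfl, (mul_one _).symm⟩
      · exact absurd (Function.extend_apply' _ _ _ hg') hg⟩
  map_add' v w := by
    ext g
    by_cases hg : ∃ h, φ h = g
    · obtain ⟨h, rfl⟩ := hg
      simp [hφ.extend_apply]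
    · simp [Function.extend_apply' _ _ _ hg]
  map_smul' a v := by
    ext g
    by_cases hg : ∃ h, φ h = g
    · obtain ⟨h, rfl⟩ := hg
      simp [hφ.extend_apply]
    · simp [Function.extend_apply' _ _ _ hg]

variable {φ : H →* G} {ρ : Representation ℂ H V} {hφ : Function.Injective φ}
  {K : Subgroup H} {hK : ∀ k ∈ K, ρ k = 1} {hKo : IsOpen (K.map φ : Set G)}

theorem supportedAtOne_apply (v : V) (h : H) :
    (supportedAtOne φ ρ hφ hK hKo v : G → V) (φ h) = ρ h v :=
  hφ.extend_apply (fun h => ρ h v) 0 h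

theorem supportedAtOne_apply_of_notMem (v : V) {g : G} (hg : g ∉ φ.range) :
    (supportedAtOne φ ρ hφ hK hKo v : G → V) g = 0 :=
  Function.extend_apply' (fun h => ρ h v) (0 : G → V) g hg

theorem eq_supportedAtOne {f : compactIndV φ ρ} (hf : ∀ g ∉ φ.range, (f : G → V) g = 0) :
    f = supportedAtOne φ ρ hφ hK hKo ((f : G → V) 1) := by
  ext g
  by_cases hg : g ∈ φ.range
  · obtain ⟨h, rfl⟩ := hg
    rw [supportedAtOne_apply, ← compactIndV_apply_mul, mul_one]
  · rw [hf g hg, supportedAtOne_apply_of_notMem _ hg]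

theorem compactInd_supportedAtOne (h : H) (v : V) :
    compactInd φ ρ (φ h) (supportedAtOne φ ρ hφ hK hKo v) =
      supportedAtOne φ ρ hφ hK hKo (ρ h v) := by
  have h1 : ∀ g ∉ φ.range, (compactInd φ ρ (φ h) (supportedAtOne φ ρ hφ hK hKo v) : G → V) g
      = 0 := by
    intro g hg
    rw [compactInd_apply]
    refine supportedAtOne_apply_of_notMem _ fun hgh => hg ?_
    simpa using φ.range.mul_mem hgh (φ.range.inv_mem ⟨h, rfl⟩)
  rw [eq_supportedAtOne (hφ := hφ) (hK := hK) (hKo := hKo) h1]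
  congr 1
  rw [compactInd_apply, one_mul, supportedAtOne_apply]

theorem isOpen_range_of_map (hKo : IsOpen (K.map φ : Set G)) : IsOpen (φ.range : Set G) :=
  Subgroup.isOpen_mono (Subgroup.map_le_range φ K) hKo

/-- Every element of the compactly induced representation is a finite sum of translates of
functions supported on the image of `H`. -/
theorem exists_eq_sum_supportedAtOne (f : compactIndV φ ρ) :
    ∃ T : Finset G, f = ∑ x ∈ T, compactInd φ ρ x⁻¹
      (supportedAtOne φ ρ hφ hK hKo ((f : G → V) x)) := by
  classical
  obtain ⟨C, hC, hsupp⟩ := f.2.2.2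
  let r := QuotientGroup.rightRel φ.range
  have hr : ∀ {a b : G}, (Quotient.mk r a = Quotient.mk r b) ↔ b * a⁻¹ ∈ φ.range := by
    intro a b
    rw [Quotient.eq, QuotientGroup.rightRel_apply]
  -- Right cosets of the open image of `H` cover the compact set `C`, so finitely many cosets
  -- contain the support; one representative of each is used.
  obtain ⟨t, -, ht⟩ := hC.elim_nhds_subcover (fun c => {x | x * c⁻¹ ∈ φ.range}) fun c _ => by
    have hcont : Continuous fun x : G => x * c⁻¹ := by fun_prop
    refine ((isOpen_range_of_map hKo).preimage hcont).mem_nhds ?_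
    change c * c⁻¹ ∈ φ.range
    rw [mul_inv_cancel]
    exact φ.range.one_mem
  let D : Finset (Quotient r) := t.image (Quotient.mk r)
  have hout : Function.Injective (Quotient.out : Quotient r → G) := Quotient.out_injective
  refine ⟨D.map ⟨Quotient.out, hout⟩, ?_⟩
  rw [Finset.sum_map]
  ext g
  rw [Submodule.coe_sum, Finset.sum_apply]
  simp only [Function.Embedding.coeFn_mk, compactInd_apply]
  have hterm : ∀ q : Quotient r, (supportedAtOne φ ρ hφ hK hKo ((f : G → V) q.out) : G → V)
      (g * q.out⁻¹) = if q = Quotient.mk r g then (f : G → V) g else 0 := by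
    intro q
    have hq : q = Quotient.mk r g ↔ g * q.out⁻¹ ∈ φ.range := by
      rw [← hr, Quotient.out_eq]
    split_ifs with h
    · obtain ⟨h', hh'⟩ := hq.1 h
      rw [← hh', supportedAtOne_apply, ← compactIndV_apply_mul, hh', inv_mul_cancel_right]
    · exact supportedAtOne_apply_of_notMem _ fun h' => h (hq.2 h')
  rw [Finset.sum_congr rfl fun q _ => hterm q, Finset.sum_ite_eq']
  split_ifs with hD
  · rfl
  · by_contra hg
    obtain ⟨h, c, hc, rfl⟩ := hsupp g hg
    obtain ⟨x, hx, hcx⟩ := Set.mem_iUnion₂.1 (ht hc)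
    refine hD (Finset.mem_image.2 ⟨x, hx, hr.2 ?_⟩)
    rw [mul_assoc]
    exact φ.range.mul_mem ⟨h, rfl⟩ hcx

end CompactInduction

section Criterion

open scoped Pointwise

variable {H Q G V : Type*} [Group H] [Group Q] [Group G] [TopologicalSpace G]
  [IsTopologicalGroup G] [AddCommGroup V] [Module ℂ V]

/-- Irreducibility criterion: a compactly induced representation is irreducible if only the
elements `g` of the inducing subgroup admit nonzero vectors fixed by `H ∩ g K g⁻¹`. -/
theorem compactInd_isIrreducible {φ : H →* G} {red : H →* Q} {δ : Representation ℂ Q V}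
    (hφ : Function.Injective φ) (hred : Function.Surjective red) (hδ : δ.IsIrreducible)
    (hKo : IsOpen (red.ker.map φ : Set G)) (hKc : IsCompact (red.ker.map φ : Set G))
    (hN : ∀ (g : G) (v : V), v ≠ 0 →
      (∀ h, g⁻¹ * φ h * g ∈ red.ker.map φ → δ (red h) v = v) → g ∈ φ.range) :
    (compactInd φ (δ.comp red)).IsIrreducible := by
  have hK : ∀ k ∈ red.ker, (δ.comp red : Representation ℂ H V) k = 1 := by
    intro k hk
    rw [MonoidHom.comp_apply, MonoidHom.mem_ker.1 hk, map_one]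
  let s := supportedAtOne φ (δ.comp red) hφ hK hKo
  have hsv : ∀ v, (s v : G → V) 1 = v := by
    intro v
    have := supportedAtOne_apply (hφ := hφ) (hK := hK) (hKo := hKo) v 1
    rwa [map_one, map_one, Module.End.one_apply] at this
  have hV : ∃ v : V, v ≠ 0 := by
    by_contra! h
    have : IsSimpleOrder (Subrepresentation δ) := hδ
    refine (bot_ne_top : (⊥ : Subrepresentation δ) ≠ ⊤) ?_
    refine SetLike.ext fun v => ?_
    rw [h v]
    exact ⟨fun _ => trivial, fun _ => Submodule.zero_mem _⟩
  obtain ⟨v₀, hv₀⟩ := hV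
  have hne : (⊥ : Subrepresentation (compactInd φ (δ.comp red))) ≠ ⊤ := by
    intro h
    have h1 : s v₀ ∈ (⊥ : Subrepresentation (compactInd φ (δ.comp red))).toSubmodule := by
      rw [h]
      trivial
    have h2 : s v₀ = 0 := h1
    refine hv₀ ?_
    rw [← hsv v₀, h2]
    rfl
  refine { exists_pair_ne := ⟨⊥, ⊤, hne⟩, eq_bot_or_eq_top := fun T => ?_ }
  by_cases hT : ∃ f ∈ T.toSubmodule, f ≠ 0
  · right
    obtain ⟨f, hfT, hf⟩ := hT
    obtain ⟨g, hg⟩ : ∃ g, (f : G → V) g ≠ 0 := by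
      by_contra! h
      exact hf (Subtype.ext (funext h))
    -- The translate by `g` moves a nonzero value to 1. As the inducing representation is trivial on
    -- the kernel of `red`, averaging over its image multiplies this value by `k`.
    obtain ⟨k, t, hk, htK, hinv⟩ := exists_sum_translates_invariant (compactInd φ (δ.comp red)) hKc
      (compactInd_isSmoothRep φ (δ.comp red) (compactInd φ (δ.comp red) g f))
    set F := ∑ i, compactInd φ (δ.comp red) (t i) (compactInd φ (δ.comp red) g f) with hF
    have hFT : F ∈ T.toSubmodule := Submodule.sum_mem _ fun i _ =>
      T.apply_mem_toSubmodule _ (T.apply_mem_toSubmodule _ hfT)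
    have hF1 : (F : G → V) 1 = (k : ℂ) • (f : G → V) g := by
      rw [hF, Submodule.coe_sum, Finset.sum_apply]
      have : ∀ i, (compactInd φ (δ.comp red) (t i) (compactInd φ (δ.comp red) g f) : G → V) 1 =
          (f : G → V) g := by
        intro i
        obtain ⟨x, hx, hxt⟩ := htK i
        rw [compactInd_apply, compactInd_apply, one_mul, ← hxt, compactIndV_apply_mul, hK x hx,
          Module.End.one_apply]
      rw [Finset.sum_congr rfl fun i _ => this i]
      simp [Nat.cast_smul_eq_nsmul]
    have hF0 : (F : G → V) 1 ≠ 0 := by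
      rw [hF1]
      exact smul_ne_zero (Nat.cast_ne_zero.2 hk) hg
    have hFs : F = s ((F : G → V) 1) := by
      refine eq_supportedAtOne fun x hx => ?_
      by_contra h0
      exact hx (hN x _ h0 fun h hh => compactIndV_apply_fixed hinv x h hh)
    have hsT : ∀ v, s v ∈ T.toSubmodule := by
      intro v
      have hv : v ∈ Submodule.span ℂ (Set.range fun q => δ q ((F : G → V) 1)) := by
        rw [span_orbit_eq_top hδ hF0]
        trivial
      induction hv using Submodule.span_induction with
      | mem v hv =>
        obtain ⟨q, rfl⟩ := hv
        obtain ⟨h, rfl⟩ := hred q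
        have h1 := T.apply_mem_toSubmodule (φ h) hFT
        rw [hFs, compactInd_supportedAtOne] at h1
        exact h1
      | zero => rw [map_zero]; exact Submodule.zero_mem _
      | add x y _ _ hx hy => rw [map_add]; exact Submodule.add_mem _ hx hy
      | smul a x _ hx => rw [map_smul]; exact Submodule.smul_mem _ a hx
    refine Subrepresentation.toSubmodule_injective (eq_top_iff.2 fun f' _ => ?_)
    obtain ⟨D, hD⟩ := exists_eq_sum_supportedAtOne (hφ := hφ) (hK := hK) (hKo := hKo) f'
    rw [hD]
    exact Submodule.sum_mem _ fun x _ => T.apply_mem_toSubmodule _ (hsT _)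
  · left
    push Not at hT
    refine Subrepresentation.toSubmodule_injective (eq_bot_iff.2 fun f hf => ?_)
    exact hT f hf

/-- Supercuspidality criterion: a representation compactly induced from a compact open subgroup is
supercuspidal if, for every compact open subgroup `U`, the elements `g` that admit nonzero vectors
fixed by `H ∩ g U g⁻¹` lie in a compact set. -/
theorem compactInd_isSupercuspidalRep {φ : H →* G} {ρ : Representation ℂ H V}
    [FiniteDimensional ℂ V] (hHo : IsOpen (φ.range : Set G)) (hHc : IsCompact (φ.range : Set G))
    (hB : ∀ U : Subgroup G, IsOpen (U : Set G) → ∃ C : Set G, IsCompact C ∧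
      ∀ (g : G) (v : V), v ≠ 0 → (∀ h, g⁻¹ * φ h * g ∈ U → ρ h v = v) → g ∈ C) :
    IsSupercuspidalRep (compactInd φ ρ) := by
  refine ⟨⟨compactInd_isSmoothRep φ ρ, fun U hU _ => ?_⟩, fun f ξ hξ => ?_⟩
  · obtain ⟨C, hC, hCB⟩ := hB U hU
    -- A `U`-invariant function is supported in `C`, which meets finitely many left cosets of `U`;
    -- values at their representatives determine it.
    obtain ⟨t, -, ht⟩ := hC.elim_nhds_subcover (fun c => {x | c⁻¹ * x ∈ U}) fun c _ => by
      have hcont : Continuous fun x : G => c⁻¹ * x := by fun_prop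
      refine (hU.preimage hcont).mem_nhds ?_
      simp [U.one_mem]
    let ev : Representation.invariants ((compactInd φ ρ).comp U.subtype) →ₗ[ℂ] (t → V) :=
      LinearMap.pi fun x => (LinearMap.proj (x : G)).comp
        ((compactIndV φ ρ).subtype.comp (Submodule.subtype _))
    refine FiniteDimensional.of_injective ev fun f₁ f₂ hf => ?_
    have hinv : ∀ u ∈ U, compactInd φ ρ u (f₁.1 - f₂.1) = f₁.1 - f₂.1 := fun u hu => by
      rw [map_sub]
      exact congrArg₂ _ ((Representation.mem_invariants _ _).1 f₁.2 ⟨u, hu⟩)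
        ((Representation.mem_invariants _ _).1 f₂.2 ⟨u, hu⟩)
    refine Subtype.ext (Subtype.ext (funext fun g => ?_))
    by_contra hg
    have hgC := hCB g (((f₁.1 - f₂.1 : compactIndV φ ρ) : G → V) g) (sub_ne_zero.2 hg)
      fun h hh => compactIndV_apply_fixed hinv g h hh
    obtain ⟨x, hx, hgx⟩ := Set.mem_iUnion₂.1 (ht hgC)
    have h1 := congrFun (congrArg Subtype.val (hinv _ hgx)) x
    rw [compactInd_apply, mul_inv_cancel_left] at h1
    exact hg (sub_eq_zero.1 (h1.trans (sub_eq_zero.2 (congrFun hf ⟨x, hx⟩))))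
  · obtain ⟨U, hU, hUξ⟩ := hξ
    -- Intersecting with the compact image of `H` gives a compact open subgroup fixing ξ, over which
    -- averaging is possible.
    have hU'o : IsOpen ((U ⊓ φ.range : Subgroup G) : Set G) := hU.inter hHo
    have hU'c : IsCompact ((U ⊓ φ.range : Subgroup G) : Set G) :=
      hHc.of_isClosed_subset (Subgroup.isClosed_of_isOpen _ hU'o) fun _ hx => hx.2
    obtain ⟨C, hC, hCB⟩ := hB _ hU'o
    obtain ⟨D, hD, hsupp⟩ := f.2.2.2
    -- If the coefficient is nonzero at `g`, the average of the `g`-translate of `f` is nonzero at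
    -- some `x` in `C`. Hence some `x t_i g` lies in the support of `f`, contained in `φ(H) D`, and
    -- solving for `g` gives this product of compact sets.
    refine ⟨((U ⊓ φ.range : Subgroup G) : Set G)⁻¹ * (C⁻¹ * ((φ.range : Set G) * D)),
      hU'c.inv.mul (hC.inv.mul (hHc.mul hD)), fun g hg => ?_⟩
    obtain ⟨k, t, hk, htU, hinv⟩ := exists_sum_translates_invariant (compactInd φ ρ) hU'c
      (compactInd_isSmoothRep φ ρ (compactInd φ ρ g f))
    set F := ∑ i, compactInd φ ρ (t i) (compactInd φ ρ g f) with hF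
    have hξF : ξ F = (k : ℂ) • ξ (compactInd φ ρ g f) := by
      rw [hF, map_sum]
      have : ∀ i, ξ (compactInd φ ρ (t i) (compactInd φ ρ g f)) = ξ (compactInd φ ρ g f) := by
        intro i
        have h1 := LinearMap.congr_fun (hUξ _ (U.inv_mem (htU i).1)) (compactInd φ ρ g f)
        rw [Representation.dual_apply, inv_inv] at h1
        exact h1
      rw [Finset.sum_congr rfl fun i _ => this i]
      simp
    have hF0 : F ≠ 0 := by
      intro h
      rw [h, map_zero] at hξF
      exact smul_ne_zero (Nat.cast_ne_zero.2 hk) hg hξF.symm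
    obtain ⟨x, hx⟩ : ∃ x, (F : G → V) x ≠ 0 := by
      by_contra! h
      exact hF0 (Subtype.ext (funext h))
    have hxC := hCB x _ hx fun h hh => compactIndV_apply_fixed hinv x h hh
    obtain ⟨i, hi⟩ : ∃ i, (f : G → V) (x * t i * g) ≠ 0 := by
      by_contra! h
      refine hx ?_
      rw [hF, Submodule.coe_sum, Finset.sum_apply]
      exact Finset.sum_eq_zero fun i _ => h i
    obtain ⟨h, d, hd, hxd⟩ := hsupp _ hi
    refine ⟨g, ⟨(t i)⁻¹, Set.inv_mem_inv.2 (htU i), x⁻¹ * (φ h * d),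
      ⟨x⁻¹, Set.inv_mem_inv.2 hxC, φ h * d, ⟨φ h, ⟨h, rfl⟩, d, hd, rfl⟩, rfl⟩, ?_⟩, 1,
      Subgroup.one_mem _, (mul_one g).symm⟩
    change (t i)⁻¹ * (x⁻¹ * (φ h * d)) = g
    rw [← hxd]
    group

end Criterion

/-! ### Conclusion for SL_n(F) -/

section Main

variable {F : Type*} [Field F] [ValuativeRel F] [TopologicalSpace F]
  [IsNonarchimedeanLocalField F]

theorem mem_range_slInclusion_of_zero {ϖ : 𝒪[F]} {n : ℕ} {g : SpecialLinearGroup (Fin n) F}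
    {k₁ k₂ : Matrix (Fin n) (Fin n) 𝒪[F]}
    (hg : (g : Matrix (Fin n) (Fin n) F) = (algebraMap 𝒪[F] F).mapMatrix k₁ *
        diagonal (fun i => (ϖ : F) ^ ((0 : Fin n → ℤ) i)) *
        (algebraMap 𝒪[F] F).mapMatrix k₂) : g ∈ (slInclusion F n).range := by
  obtain ⟨k, _, hk⟩ := exists_slInclusion_eq (g := g) (c := k₁ * k₂) (by
    rw [hg, map_mul]
    simp)
  exact ⟨k, hk⟩

theorem pow_mul_mem_of_cartan {ϖ : 𝒪[F]} (hϖ : Irreducible ϖ) {n N : ℕ}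
    {g : SpecialLinearGroup (Fin n) F}
    {k₁ k₂ : Matrix (Fin n) (Fin n) 𝒪[F]} {v : Fin n → ℤ} (hv : ∑ i, v i = 0)
    (hN : ∀ i j, v j ≤ v i + N)
    (hg : (g : Matrix (Fin n) (Fin n) F) = (algebraMap 𝒪[F] F).mapMatrix k₁ *
        diagonal (fun i => (ϖ : F) ^ v i) * (algebraMap 𝒪[F] F).mapMatrix k₂) (i j : Fin n) :
    (ϖ : F) ^ N * g i j ∈ 𝒪[F] := by
  have h0 := coe_uniformizer_ne_zero hϖ
  -- If `v a < -N`, the bound on the spread makes every exponent negative, contradicting the zero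
  -- sum.
  have hpos : ∀ a, 0 ≤ v a + N := by
    intro a
    by_contra! ha
    have : ∑ b, v b < 0 :=
      Finset.sum_neg (fun b _ => by have := hN a b; omega) ⟨a, Finset.mem_univ a⟩
    omega
  have h1 : (ϖ : F) ^ N • (g : Matrix (Fin n) (Fin n) F) =
      (algebraMap 𝒪[F] F).mapMatrix (k₁ * diagonal (fun a => ϖ ^ (v a + N).toNat) * k₂) := by
    have h2 : (algebraMap 𝒪[F] F).mapMatrix (diagonal fun a => ϖ ^ (v a + N).toNat) =
        (ϖ : F) ^ N • diagonal (fun a => (ϖ : F) ^ v a) := by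
      ext a b
      rcases eq_or_ne a b with rfl | hab
      · simp only [RingHom.mapMatrix_apply, Matrix.map_apply, diagonal_apply_eq, map_pow,
          Matrix.smul_apply, smul_eq_mul, algebraMap_integer_apply]
        rw [← zpow_natCast, ← zpow_natCast, Int.toNat_of_nonneg (hpos a), zpow_add₀ h0, mul_comm]
      · simp [hab]
    rw [map_mul, map_mul, h2, hg, Matrix.mul_smul, Matrix.smul_mul]
  have h3 := congrFun (congrFun h1 i) j
  change (ϖ : F) ^ N * g i j = _ at h3
  rw [h3]
  exact Subtype.coe_prop _

end Main

/-- Here `O_K` is the integral closure of `O_F` in `K`, `𝔓` is its maximal ideal,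
`e = 𝔓.ramificationIdx 𝒪[F]`, and `Algebra.leftMulMatrix b β` is the matrix of multiplication by
`β` with respect to the `O_F`-basis `b` of `O_K`. -/
theorem mainTheorem1
    {F : Type*} [Field F] [ValuativeRel F] [TopologicalSpace F] [IsNonarchimedeanLocalField F]
    (hF : ringChar 𝓀[F] ≠ 2)
    (τ : AddChar F Circle) (hτ : Continuous τ) (hτO : HasConductorO τ)
    (ϖ : 𝒪[F]) (hϖ : Irreducible ϖ)
    {K : Type*} [Field K] [Algebra F K]
    (n : ℕ) (hn : Module.finrank F K = n) (hpn : ¬ ringChar 𝓀[F] ∣ n)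
    (𝔓 : Ideal (integralClosure 𝒪[F] K)) (h𝔓 : 𝔓.IsMaximal)
    (b : Module.Basis (Fin n) 𝒪[F] (integralClosure 𝒪[F] K))
    (β : integralClosure 𝒪[F] K) (hβ : Algebra.adjoin 𝒪[F] {β} = ⊤)
    (hβtr : Algebra.trace F K (β : K) = 0)
    (r : ℕ) (hr2 : 2 ≤ r)
    {V : Type*} [AddCommGroup V] [Module ℂ V]
    (δ : Representation ℂ (SpecialLinearGroup (Fin n) (𝒪[F] ⧸ 𝓂[F] ^ r)) V)
    (hδ : δ.IsIrreducible)
    (hδβ : ContainsCharacter δ (halfKernel F n r)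
      (psi τ hτO.apply_eq_one ϖ hϖ r (Algebra.leftMulMatrix b β)))
    (hr : 2 * 𝔓.ramificationIdx 𝒪[F] ≤ r) :
    (compactInd (slInclusion F n) (δ.comp (slReduction F n r))).IsIrreducible ∧
      IsSupercuspidalRep (compactInd (slInclusion F n) (δ.comp (slReduction F n r))) := by
  have := finiteDimensional_of_basis_integralClosure hn b
  have := isLocalRing_integralClosure b
  have := isDedekindDomain_integralClosure b
  have := IsIrreducible.finiteDimensional hδ
  obtain rfl := IsLocalRing.eq_maximalIdeal h𝔓
  have hr0 : r ≠ 0 := by omega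
  have hKo : IsOpen ((slReduction F n r).ker.map (slInclusion F n) : Set (SpecialLinearGroup (Fin n) F)) :=
    isOpen_congruenceSubgroup hϖ n r
  constructor
  · refine compactInd_isIrreducible (slInclusion_injective n) (slReduction_surjective n hr0) hδ hKo
      (isCompact_congruenceSubgroup hϖ n r) fun g w hw hfix => ?_
    obtain ⟨k₁, k₂, v, hk₁, hk₂, hv, hg⟩ := exists_cartan_decomposition hϖ g
    obtain ⟨κ, hκ, hdvd⟩ := exists_conj_forall_dvd hτO hϖ hr0 hδ hδβ hk₁ hk₂ hg hw hfix
    obtain rfl := eq_zero_of_forall_dvd_conj b hϖ hβ hr2 hr hκ hv hdvd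
    exact mem_range_slInclusion_of_zero hg
  · refine compactInd_isSupercuspidalRep (isOpen_range_of_map hKo)
      (isCompact_range_slInclusion hϖ n) fun U hU => ?_
    obtain ⟨m, hm⟩ := exists_congruenceSubgroup_le hϖ hU
    refine ⟨_, isCompact_setOf_pow_mul_mem hϖ n (n * (m + 1)), fun g w hw hfix => ?_⟩
    obtain ⟨k₁, k₂, v, hk₁, hk₂, hv, hg⟩ := exists_cartan_decomposition hϖ g
    obtain ⟨κ, hκ, hdvd⟩ := exists_conj_forall_dvd hτO hϖ hr0 hδ hδβ hk₁ hk₂ hg hw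
      fun k hk => hfix k (hm hk)
    refine pow_mul_mem_of_cartan hϖ hv (fun i j => ?_) hg
    -- Taking `t = 0` and dropping the nonnegative term `(r + 1) / 2` gives a bound depending only
    -- on `n` and the level `m` of `U`.
    have := sub_le_of_forall_dvd_conj b hϖ hβ hr2 hr hκ (v := v) (m := m)
      (fun i j hij hmv => by simpa using hdvd i j hij 0 (by omega)) i j
    push_cast
    exact this
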